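/- Let $K$ be a field and $G$ a group. A $G$-algebra is a unital associative $K$-algebra on which $G$ acts (on the left) by $K$-algebra automorphisms. For a $G$-algebra $A$, the skew group algebra $A*G$ is the free left $A$-module with basis $G$ and multiplication determined by those of $A$ and $G$ and $ga=g(a)g$ for $a\in A$, $g\in G$. Let $G\text{-}\mathrm{Mod}$ be the monoidal category of all $K$-linear $G$-modules, with $\otimes=\otimes_K$. The category $A*G\text{-}\mathrm{Mod}$ of all left $A*G$-modules is a right module category over $G\text{-}\mathrm{Mod}$: $X\boxtimes V$ is $X\otimes_K V$ with $A$ acting on the first factor and $G$ acting diagonally, with the usual associativity and unit isomorphisms $X\boxtimes(V\otimes V')\cong(X\boxtimes V)\boxtimes V'$ and $X\boxtimes K\cong X$. Two right module categories are equivalent as module categories over $G\text{-}\mathrm{Mod}$ if there is an equivalence of categories $F$ between them together with isomorphisms $F(X)\boxtimes V\cong F(X\boxtimes V)$, natural in $X$ and $V$ and compatible with the associativity and unit isomorphisms. A Morita context $(A,B,{}_AM_B,{}_BN_A,\phi,\psi)$ between $K$-algebras $A$ and $B$ consists of an $A$-$B$-bimodule $M$ and a $B$-$A$-bimodule $N$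 (with equal left and right actions of $K$) and bimodule maps $\phi:M\otimes_BN\to A$ and $\psi:N\otimes_AM\to B$ such that $\phi(m\otimes n)m'=m\,\psi(n\otimes m')$ and $\psi(n\otimes m)n'=n\,\phi(m\otimes n')$ for all $m,m'\in M$, $n,n'\in N$. It is nondegenerate if $\phi$ and $\psi$ are isomorphisms. If $A$ and $B$ are $G$-algebras, it is $G$-equivariant if $M$ and $N$ are ($K$-linear) $G$-modules such that $g\cdot(amb)=(g\cdot a)(g\cdot m)(g\cdot b)$ and $g\cdot(bna)=(g\cdot b)(g\cdot n)(g\cdot a)$ for all $g\in G$, $a\in A$, $b\in B$, $m\in M$, $n\in N$, and $\phi$ and $\psi$ are homomorphisms of $G$-modules, where $G$ acts diagonally on $M\otimes_BN$ and $N\otimes_AM$. Lemma. Let $A$ and $B$ be $G$-algebras. The categories $A*G\text{-}\mathrm{Mod}$ and $B*G\text{-}\mathrm{Mod}$ are equivalent as module categories over $G\text{-}\mathrm{Mod}$ if and only if there exists a nondegenerate $G$-equivariant Morita context $(A,B,{}_AM_B,{}_BN_A,\phi,\psi)$. -/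

import Mathlib

open CategoryTheory MonoidalCategory TensorProduct

universe u v

noncomputable section

/-! ### The category of `A ∗ G`-modules as a right module category over `G`-modules

Throughout, a `G`-algebra over the field `K` is a unital associative `K`-algebra `A` on which `G`
acts by `K`-algebra automorphisms (`MulSemiringAction G A` and `SMulCommClass G K A`).
The skew group algebra `A ∗ G` is `SkewMonoidAlgebra A G`, in which `single g a` stands for `a g`
and `single g a * single h b = single (g * h) (a * g • b)`. -/

namespace SkewTensor

section Unbundled

variable (K : Type u) [Field K] {G : Type v} [Group G]
  {A : Type u} [Ring A] [Algebra K A] [MulSemiringAction G A] [SMulCommClass G K A]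

theorem single_eq (g : G) (a : A) :
    SkewMonoidAlgebra.single g a =
      SkewMonoidAlgebra.single 1 a * SkewMonoidAlgebra.single g (1 : A) := by
  simp

/-- An additive map that commutes with all `single g a` is `A ∗ G`-linear. -/
def linearMapOfSingle {X Y : Type u} [AddCommGroup X] [AddCommGroup Y]
    [Module (SkewMonoidAlgebra A G) X] [Module (SkewMonoidAlgebra A G) Y] (f : X →+ Y)
    (hf : ∀ (g : G) (a : A) (x : X),
      f (SkewMonoidAlgebra.single g a • x) = SkewMonoidAlgebra.single g a • f x) :
    X →ₗ[SkewMonoidAlgebra A G] Y where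
  toFun := f
  map_add' := f.map_add
  map_smul' r x := by
    induction r using SkewMonoidAlgebra.induction with
    | h0 => simp
    | ha g a r _ _ ih => simp only [RingHom.id_apply] at *; rw [add_smul, map_add, ih, hf, add_smul]

variable (M : Type u) [AddCommGroup M] [Module K M] [Module (SkewMonoidAlgebra A G) M]
  [IsScalarTower K (SkewMonoidAlgebra A G) M] {V : Type u} [AddCommGroup V] [Module K V]

/-- The action of `A ∗ G` on `M ⊗ V`: `A` acts on the first factor and `G` acts diagonally. -/
def action (ρ : Representation K G V) :
    SkewMonoidAlgebra A G →ₐ[K] Module.End K (M ⊗[K] V) :=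
  SkewMonoidAlgebra.liftNCAlgHom
    (AlgHom.ofLinearMap
      { toFun := fun a => (Algebra.lsmul K K M (SkewMonoidAlgebra.single (1 : G) a)).rTensor V
        map_add' := fun a b => by
          rw [SkewMonoidAlgebra.single_add, map_add, LinearMap.rTensor_add]
        map_smul' := fun k a => by
          rw [← SkewMonoidAlgebra.smul_single, map_smul, LinearMap.rTensor_smul]; rfl }
      (by
        ext m v
        simp)
      (fun a b => by
        ext m v
        simp [smul_smul]))
    { toFun := fun g =>
        TensorProduct.map (Algebra.lsmul K K M (SkewMonoidAlgebra.single g (1 : A))) (ρ g)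
      map_one' := by
        ext m v
        simp
      map_mul' := fun g h => by
        ext m v
        simp [smul_smul] }
    (by
      intro a g
      ext m v
      simp [smul_smul])

theorem action_single_tmul (ρ : Representation K G V) (g : G) (a : A) (m : M) (v : V) :
    action K M ρ (SkewMonoidAlgebra.single g a) (m ⊗ₜ[K] v) =
      (SkewMonoidAlgebra.single g a • m) ⊗ₜ[K] (ρ g v) := by
  simp [action, SkewMonoidAlgebra.liftNCAlgHom, SkewMonoidAlgebra.liftNCRingHom, smul_smul]

end Unbundled

section Bundled

variable {K : Type u} [Field K] {G : Type v} [Group G]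
  {A : Type u} [Ring A] [Algebra K A] [MulSemiringAction G A] [SMulCommClass G K A]

-- Every `A ∗ G`-module is regarded as a `K`-vector space through `K → A ∗ G`.
open scoped ModuleCat

/-- The `K`-vector space `M ⊗ V`, as a type of its own, because Mathlib already lets `A ∗ G` act on
`M ⊗[K] V` through the first factor alone. -/
def Carrier (M : ModuleCat.{u} (SkewMonoidAlgebra A G)) (V : Rep.{u} K G) : Type u :=
  M ⊗[K] V

instance (M : ModuleCat.{u} (SkewMonoidAlgebra A G)) (V : Rep.{u} K G) :
    AddCommGroup (Carrier M V) :=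
  inferInstanceAs (AddCommGroup (M ⊗[K] V))

/-- The `A ∗ G`-module structure of `M ⊠ V`: `a g` acts by `m ⊗ v ↦ (a g • m) ⊗ (g • v)`. -/
instance (M : ModuleCat.{u} (SkewMonoidAlgebra A G)) (V : Rep.{u} K G) :
    Module (SkewMonoidAlgebra A G) (Carrier M V) :=
  Module.compHom (M ⊗[K] V) (action K M V.ρ).toRingHom

/-- The object `M ⊠ V`. -/
def obj (M : ModuleCat.{u} (SkewMonoidAlgebra A G)) (V : Rep.{u} K G) :
    ModuleCat.{u} (SkewMonoidAlgebra A G) :=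
  ModuleCat.of (SkewMonoidAlgebra A G) (Carrier M V)

/-- The identity, as a `K`-linear map between `M ⊗ V` and the vector space underlying `M ⊠ V`. -/
def objEquiv (M : ModuleCat.{u} (SkewMonoidAlgebra A G)) (V : Rep.{u} K G) :
    (M ⊗[K] V) ≃ₗ[K] (obj M V) where
  toFun x := x
  invFun x := x
  map_add' _ _ := rfl
  map_smul' k x := by
    change k • x = action K M V.ρ (algebraMap K (SkewMonoidAlgebra A G) k) x
    rw [AlgHom.commutes]; rfl
  left_inv _ := rfl
  right_inv _ := rfl

/-- The pure tensor `m ⊗ v` as an element of `M ⊠ V`. -/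
def mk {M : ModuleCat.{u} (SkewMonoidAlgebra A G)} {V : Rep.{u} K G} (m : M) (v : V) : obj M V :=
  objEquiv M V (m ⊗ₜ[K] v)

@[simp]
theorem objEquiv_tmul {M : ModuleCat.{u} (SkewMonoidAlgebra A G)} {V : Rep.{u} K G}
    (m : M) (v : V) : objEquiv M V (m ⊗ₜ[K] v) = mk m v := rfl

@[simp]
theorem objEquiv_symm_mk {M : ModuleCat.{u} (SkewMonoidAlgebra A G)} {V : Rep.{u} K G}
    (m : M) (v : V) : (objEquiv M V).symm (mk m v) = m ⊗ₜ[K] v := rfl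

@[simp]
theorem single_smul_mk {M : ModuleCat.{u} (SkewMonoidAlgebra A G)} {V : Rep.{u} K G}
    (g : G) (a : A) (m : M) (v : V) :
    SkewMonoidAlgebra.single g a • (mk m v : obj M V) =
      mk (SkewMonoidAlgebra.single g a • m) (V.ρ g v) :=
  action_single_tmul K M V.ρ g a m v

@[elab_as_elim]
theorem obj_induction {M : ModuleCat.{u} (SkewMonoidAlgebra A G)} {V : Rep.{u} K G}
    {p : obj M V → Prop} (x : obj M V) (h0 : p 0) (hmk : ∀ m v, p (mk m v))
    (hadd : ∀ x y, p x → p y → p (x + y)) : p x :=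
  TensorProduct.induction_on (motive := fun x => p (objEquiv M V x)) ((objEquiv M V).symm x)
    h0 hmk (fun _ _ => hadd _ _)

theorem mk_add {M : ModuleCat.{u} (SkewMonoidAlgebra A G)} {V : Rep.{u} K G} (m : M) (v w : V) :
    mk m (v + w) = mk m v + mk m w := by
  simp only [← objEquiv_tmul, TensorProduct.tmul_add, map_add]

theorem add_mk {M : ModuleCat.{u} (SkewMonoidAlgebra A G)} {V : Rep.{u} K G} (m n : M) (v : V) :
    mk (m + n) v = mk m v + mk n v := by
  simp only [← objEquiv_tmul, TensorProduct.add_tmul, map_add]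

theorem mk_zero {M : ModuleCat.{u} (SkewMonoidAlgebra A G)} {V : Rep.{u} K G} (m : M) :
    mk m (0 : V) = 0 := by
  simp only [← objEquiv_tmul, TensorProduct.tmul_zero, map_zero]

theorem zero_mk {M : ModuleCat.{u} (SkewMonoidAlgebra A G)} {V : Rep.{u} K G} (v : V) :
    mk (0 : M) v = 0 := by
  simp only [← objEquiv_tmul, TensorProduct.zero_tmul, map_zero]

theorem mk_smul {M : ModuleCat.{u} (SkewMonoidAlgebra A G)} {V : Rep.{u} K G} (k : K) (m : M)
    (v : V) : mk m (k • v) = k • mk m v := by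
  simp only [← objEquiv_tmul, TensorProduct.tmul_smul, map_smul]

theorem smul_mk {M : ModuleCat.{u} (SkewMonoidAlgebra A G)} {V : Rep.{u} K G} (k : K) (m : M)
    (v : V) : mk (k • m) v = k • mk m v := by
  rw [← objEquiv_tmul, ← TensorProduct.smul_tmul', map_smul, objEquiv_tmul]

theorem hom_ext {M N : ModuleCat.{u} (SkewMonoidAlgebra A G)} {V : Rep.{u} K G}
    {f f' : obj M V ⟶ N} (h : ∀ m v, f.hom (mk m v) = f'.hom (mk m v)) : f = f' := by
  ext x
  induction x using obj_induction with
  | h0 => simp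
  | hmk m v => exact h m v
  | hadd x y hx hy => simp only [map_add, hx, hy]

/-- An `A ∗ G`-linear map, as a `K`-linear map. -/
def restrict {M N : ModuleCat.{u} (SkewMonoidAlgebra A G)} (f : M ⟶ N) : M →ₗ[K] N where
  toFun := f.hom
  map_add' := f.hom.map_add
  map_smul' k x := f.hom.map_smul (algebraMap K (SkewMonoidAlgebra A G) k) x

/-- The morphism `f ⊠ φ`, given by `m ⊗ v ↦ f m ⊗ φ v`. -/
def map {M N : ModuleCat.{u} (SkewMonoidAlgebra A G)} {V W : Rep.{u} K G} (f : M ⟶ N)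
    (φ : V ⟶ W) : obj M V ⟶ obj N W :=
  let e : obj M V →ₗ[K] obj N W :=
    (objEquiv N W).toLinearMap ∘ₗ TensorProduct.map (restrict f) φ.hom.toLinearMap ∘ₗ
      (objEquiv M V).symm.toLinearMap
  let l : obj M V →ₗ[SkewMonoidAlgebra A G] obj N W := linearMapOfSingle e.toAddMonoidHom
    (fun g a x => by
      induction x using obj_induction with
      | h0 => simp
      | hmk m v =>
        rw [single_smul_mk]
        change mk (f.hom (SkewMonoidAlgebra.single g a • m)) (φ.hom (V.ρ g v)) =
          SkewMonoidAlgebra.single g a • mk (f.hom m) (φ.hom v)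
        rw [single_smul_mk, map_smul, Rep.hom_comm_apply]
      | hadd x y hx hy => simp only [smul_add, map_add, hx, hy])
  ModuleCat.ofHom l

@[simp]
theorem map_mk {M N : ModuleCat.{u} (SkewMonoidAlgebra A G)} {V W : Rep.{u} K G} (f : M ⟶ N)
    (φ : V ⟶ W) (m : M) (v : V) : (map f φ).hom (mk m v) = mk (f.hom m) (φ.hom v) := rfl

/-- The isomorphism `M ⊠ (V ⊗ W) ≅ (M ⊠ V) ⊠ W`, given by `m ⊗ (v ⊗ w) ↦ (m ⊗ v) ⊗ w`. -/
def assocIso (M : ModuleCat.{u} (SkewMonoidAlgebra A G)) (V W : Rep.{u} K G) :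
    obj M (V ⊗ W) ≅ obj (obj M V) W :=
  let e : obj M (V ⊗ W) ≃ₗ[K] obj (obj M V) W :=
    (objEquiv M (V ⊗ W)).symm ≪≫ₗ (TensorProduct.assoc K M V W).symm ≪≫ₗ
      TensorProduct.congr (objEquiv M V) (LinearEquiv.refl K W) ≪≫ₗ objEquiv (obj M V) W
  LinearEquiv.toModuleIso
    { linearMapOfSingle e.toLinearMap.toAddMonoidHom
        (fun g a x => by
          induction x using obj_induction with
          | h0 => simp
          | hmk m z =>
            induction z using TensorProduct.induction_on with
            | zero => simp [mk_zero]
            | tmul v w =>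
              rw [single_smul_mk]
              change mk (mk (SkewMonoidAlgebra.single g a • m) (V.ρ g v)) (W.ρ g w) =
                SkewMonoidAlgebra.single g a • mk (mk m v) w
              rw [single_smul_mk, single_smul_mk]
            | add x y hx hy => rw [mk_add, smul_add, map_add, hx, hy, map_add, smul_add]
          | hadd x y hx hy => simp only [smul_add, map_add, hx, hy]),
      e with }

@[simp]
theorem assocIso_hom_mk (M : ModuleCat.{u} (SkewMonoidAlgebra A G)) (V W : Rep.{u} K G)
    (m : M) (v : V) (w : W) :
    (assocIso M V W).hom.hom (mk (V := V ⊗ W) m (v ⊗ₜ[K] w)) = mk (mk m v) w := rfl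

@[simp]
theorem assocIso_inv_mk (M : ModuleCat.{u} (SkewMonoidAlgebra A G)) (V W : Rep.{u} K G)
    (m : M) (v : V) (w : W) :
    (assocIso M V W).inv.hom (mk (mk m v) w) = mk (V := V ⊗ W) m (v ⊗ₜ[K] w) := rfl

/-- The isomorphism `M ⊠ K ≅ M`, given by `m ⊗ k ↦ k m`. -/
def unitIso (M : ModuleCat.{u} (SkewMonoidAlgebra A G)) :
    obj M (𝟙_ (Rep.{u} K G)) ≅ M :=
  let e : obj M (𝟙_ (Rep.{u} K G)) ≃ₗ[K] M :=
    (objEquiv M (𝟙_ (Rep.{u} K G))).symm ≪≫ₗ TensorProduct.rid K M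
  LinearEquiv.toModuleIso
    { linearMapOfSingle e.toLinearMap.toAddMonoidHom
        (fun g a x => by
          induction x using obj_induction with
          | h0 => simp
          | hmk m k =>
            rw [single_smul_mk]
            change (k : K) • (_ : M) = SkewMonoidAlgebra.single g a • ((k : K) • m)
            change algebraMap K (SkewMonoidAlgebra A G) k • (SkewMonoidAlgebra.single g a • m) =
              SkewMonoidAlgebra.single g a • (algebraMap K (SkewMonoidAlgebra A G) k • m)
            rw [smul_smul, smul_smul, Algebra.commutes]
          | hadd x y hx hy => simp only [smul_add, map_add, hx, hy]),
      e with }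

@[simp]
theorem unitIso_hom_mk (M : ModuleCat.{u} (SkewMonoidAlgebra A G)) (m : M) (k : K) :
    (unitIso (K := K) M).hom.hom (mk (V := 𝟙_ (Rep.{u} K G)) m k) =
      k • m := rfl

theorem hom_ext₂ {M N : ModuleCat.{u} (SkewMonoidAlgebra A G)} {V W : Rep.{u} K G}
    {f f' : obj M (V ⊗ W) ⟶ N}
    (h : ∀ (m : M) (v : V) (w : W), f.hom (mk (V := V ⊗ W) m (v ⊗ₜ[K] w)) =
      f'.hom (mk (V := V ⊗ W) m (v ⊗ₜ[K] w))) : f = f' := by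
  refine hom_ext fun m z => ?_
  induction z using TensorProduct.induction_on with
  | zero => rw [mk_zero, map_zero, map_zero]
  | tmul v w => exact h m v w
  | add x y hx hy => rw [mk_add, map_add, map_add, hx, hy]

theorem hom_ext₃ {M N : ModuleCat.{u} (SkewMonoidAlgebra A G)} {V W X : Rep.{u} K G}
    {f f' : obj M (V ⊗ (W ⊗ X)) ⟶ N}
    (h : ∀ (m : M) (v : V) (w : W) (x : X),
      f.hom (mk (V := V ⊗ (W ⊗ X)) m (v ⊗ₜ[K] (w ⊗ₜ[K] x))) =
        f'.hom (mk (V := V ⊗ (W ⊗ X)) m (v ⊗ₜ[K] (w ⊗ₜ[K] x)))) : f = f' := by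
  refine hom_ext₂ fun m v z => ?_
  induction z using TensorProduct.induction_on with
  | zero => rw [TensorProduct.tmul_zero, mk_zero, map_zero, map_zero]
  | tmul w x => exact h m v w x
  | add x y hx hy => rw [TensorProduct.tmul_add, mk_add, map_add, map_add, hx, hy]

theorem hom_ext₃' {M N : ModuleCat.{u} (SkewMonoidAlgebra A G)} {V W X : Rep.{u} K G}
    {f f' : obj M ((V ⊗ W) ⊗ X) ⟶ N}
    (h : ∀ (m : M) (v : V) (w : W) (x : X),
      f.hom (mk (V := (V ⊗ W) ⊗ X) m ((v ⊗ₜ[K] w) ⊗ₜ[K] x)) =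
        f'.hom (mk (V := (V ⊗ W) ⊗ X) m ((v ⊗ₜ[K] w) ⊗ₜ[K] x))) : f = f' := by
  refine hom_ext₂ fun m z x => ?_
  induction z using TensorProduct.induction_on with
  | zero => rw [TensorProduct.zero_tmul, mk_zero, map_zero, map_zero]
  | tmul v w => exact h m v w x
  | add y z hy hz => rw [TensorProduct.add_tmul, mk_add, map_add, map_add, hy, hz]

/-- The right module category structure of `A ∗ G`-modules over `G`-modules. -/
instance : MonoidalRightAction (Rep.{u} K G) (ModuleCat.{u} (SkewMonoidAlgebra A G)) where
  actionObj M V := obj M V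
  actionHomRight M _ _ φ := map (𝟙 M) φ
  actionHomLeft f V := map f (𝟙 V)
  actionHom f φ := map f φ
  actionAssocIso M V W := assocIso M V W
  actionUnitIso M := unitIso M
  actionHom_def _ _ := hom_ext fun _ _ => rfl
  actionHomRight_id _ _ := hom_ext fun _ _ => rfl
  id_actionHomLeft _ _ := hom_ext fun _ _ => rfl
  actionHom_comp _ _ _ _ := hom_ext fun _ _ => rfl
  actionAssocIso_hom_naturality _ _ _ := hom_ext₂ fun _ _ _ => rfl
  actionUnitIso_hom_naturality f := hom_ext fun m k => (restrict f).map_smul (k : K) m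
  actionHomRight_whiskerRight _ _ _ := hom_ext₂ fun _ _ _ => rfl
  whiskerRight_actionHomLeft _ _ _ _ _ := hom_ext₂ fun _ _ _ => rfl
  actionHom_associator _ _ _ _ := hom_ext₃' fun _ _ _ _ => rfl
  actionHom_leftUnitor _ _ := hom_ext₂ fun m k v =>
    (mk_smul (k : K) m v).trans (smul_mk (k : K) m v).symm
  actionHom_rightUnitor _ _ := hom_ext₂ fun m v k => mk_smul (k : K) m v

end Bundled

end SkewTensor

/-! ### Equivariant Morita contexts -/

open MulOpposite

section BalancedTensor

variable (K : Type u) [Field K] (B : Type u) [Ring B]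
  (M N : Type u) [AddCommGroup M] [Module K M] [Module Bᵐᵒᵖ M]
  [AddCommGroup N] [Module K N] [Module B N]

/-- The subspace of `M ⊗[K] N` spanned by all `m b ⊗ n - m ⊗ b n`. -/
def balancedRelations : Submodule K (M ⊗[K] N) :=
  Submodule.span K
    {x | ∃ (m : M) (b : B) (n : N), x = (op b • m) ⊗ₜ[K] n - m ⊗ₜ[K] (b • n)}

/-- The tensor product `M ⊗_B N` of a right `B`-module `M` and a left `B`-module `N`, for a
possibly noncommutative `K`-algebra `B`. -/
abbrev BalancedTensor : Type u :=
  (M ⊗[K] N) ⧸ balancedRelations K B M N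

variable {M N}

/-- The pure tensor `m ⊗ n` in `M ⊗_B N`. -/
def BalancedTensor.tmul (m : M) (n : N) : BalancedTensor K B M N :=
  (balancedRelations K B M N).mkQ (m ⊗ₜ[K] n)

end BalancedTensor

/-- A Morita context `(A, B, M, N, φ, ψ)` between two `K`-algebras: an `A`-`B`-bimodule `M`, a
`B`-`A`-bimodule `N` (right actions being actions of the opposite algebra), and bimodule maps
`φ : M ⊗_B N → A` and `ψ : N ⊗_A M → B` such that `φ(m ⊗ n) m' = m ψ(n ⊗ m')` and
`ψ(n ⊗ m) n' = n φ(m ⊗ n')`. Since pure tensors span, that `φ` and `ψ` are bimodule maps is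
expressed on pure tensors. -/
structure MoritaContext (K : Type u) [Field K] (A B : Type u) [Ring A] [Algebra K A]
    [Ring B] [Algebra K B] where
  M : Type u
  N : Type u
  [addCommGroupM : AddCommGroup M]
  [moduleM : Module K M]
  [leftM : Module A M]
  [rightM : Module Bᵐᵒᵖ M]
  [bimoduleM : SMulCommClass A Bᵐᵒᵖ M]
  [leftTowerM : IsScalarTower K A M]
  [rightTowerM : IsScalarTower K Bᵐᵒᵖ M]
  [addCommGroupN : AddCommGroup N]
  [moduleN : Module K N]
  [leftN : Module B N]
  [rightN : Module Aᵐᵒᵖ N]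
  [bimoduleN : SMulCommClass B Aᵐᵒᵖ N]
  [leftTowerN : IsScalarTower K B N]
  [rightTowerN : IsScalarTower K Aᵐᵒᵖ N]
  φ : BalancedTensor K B M N →ₗ[K] A
  ψ : BalancedTensor K A N M →ₗ[K] B
  φ_left : ∀ (a : A) (m : M) (n : N), φ (.tmul K B (a • m) n) = a * φ (.tmul K B m n)
  φ_right : ∀ (a : A) (m : M) (n : N), φ (.tmul K B m (op a • n)) = φ (.tmul K B m n) * a
  ψ_left : ∀ (b : B) (n : N) (m : M), ψ (.tmul K A (b • n) m) = b * ψ (.tmul K A n m)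
  ψ_right : ∀ (b : B) (n : N) (m : M), ψ (.tmul K A n (op b • m)) = ψ (.tmul K A n m) * b
  φ_smul : ∀ (m : M) (n : N) (m' : M),
    φ (.tmul K B m n) • m' = op (ψ (.tmul K A n m')) • m
  ψ_smul : ∀ (n : N) (m : M) (n' : N),
    ψ (.tmul K A n m) • n' = op (φ (.tmul K B m n')) • n

namespace MoritaContext

attribute [instance] addCommGroupM moduleM leftM rightM bimoduleM leftTowerM rightTowerM
  addCommGroupN moduleN leftN rightN bimoduleN leftTowerN rightTowerN

variable {K : Type u} [Field K] {A B : Type u} [Ring A] [Algebra K A] [Ring B] [Algebra K B]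

/-- A Morita context is nondegenerate if `φ` and `ψ` are isomorphisms. -/
def IsNondegenerate (C : MoritaContext K A B) : Prop :=
  Function.Bijective C.φ ∧ Function.Bijective C.ψ

/-- The data making a Morita context between `G`-algebras `G`-equivariant: `G`-module structures
on `M` and `N` compatible with the bimodule structures, for which `φ` and `ψ` are homomorphisms of
`G`-modules, with `G` acting diagonally on `M ⊗_B N` and `N ⊗_A M`. -/
structure GStructure (C : MoritaContext K A B) (G : Type v) [Group G]
    [MulSemiringAction G A] [MulSemiringAction G B] where
  ρM : Representation K G C.M
  ρN : Representation K G C.N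
  ρM_smul : ∀ (g : G) (a : A) (m : C.M) (b : B),
    ρM g (a • op b • m) = (g • a) • op (g • b) • ρM g m
  ρN_smul : ∀ (g : G) (b : B) (n : C.N) (a : A),
    ρN g (b • op a • n) = (g • b) • op (g • a) • ρN g n
  φ_equivariant : ∀ (g : G) (m : C.M) (n : C.N),
    C.φ (.tmul K B (ρM g m) (ρN g n)) = g • C.φ (.tmul K B m n)
  ψ_equivariant : ∀ (g : G) (n : C.N) (m : C.M),
    C.ψ (.tmul K A (ρN g n) (ρM g m)) = g • C.ψ (.tmul K A n m)

/-- A Morita context between `G`-algebras is `G`-equivariant if it admits such a structure. -/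
def IsEquivariant (C : MoritaContext K A B) (G : Type v) [Group G]
    [MulSemiringAction G A] [MulSemiringAction G B] : Prop :=
  Nonempty (C.GStructure G)

end MoritaContext

/-- Two right module categories `D` and `D'` over a monoidal category `C` are equivalent if some
equivalence of categories `D ≌ D'` is a module functor, that is, carries natural isomorphisms
`F X ⊠ V ≅ F (X ⊠ V)` compatible with the associativity and unit isomorphisms. -/
def ModuleCategoryEquivalent (C D D' : Type*) [Category* C] [MonoidalCategory C] [Category* D]
    [Category* D'] [MonoidalRightAction C D] [MonoidalRightAction C D'] : Prop :=
  ∃ e : D ≌ D', Nonempty (e.functor.RightLinear C)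

end

/-! An `A ∗ G`-module is an `A`-module with a compatible action of `G`, and `A ⊠ V` is the module
induced from `V`: a morphism `A ⊠ V ⟶ X` is the same as a map of `G`-modules `V ⟶ X`. In particular
every `X` receives an epimorphism `A ⊠ X ⟶ X`, `a ⊗ x ↦ a x`.

Let `F` be an equivalence of module categories and put `N = F A`. Applying `F` to `A ⊠ X ⟶ X` and
using `F A ⊠ X ≅ F (A ⊠ X)` gives a pairing `N × X → F X` (`pair`), natural in `X`. For `X = A` it
is a right `A`-action, and `N` becomes a `G`-equivariant `B`-`A`-bimodule. Choose `X` with `F X ≅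
B`; each `x : X` gives a `B`-linear functional `n ↦ pair n x` on `N`. Such functionals are generally
not `G`-equivariant, hence not morphisms of the category; tensoring with the `G`-modules underlying
`X` and `N` keeps them within its reach. The epimorphism `B ⊠ N ⟶ N` comes from an epimorphism `q :
X ⊠ N ⟶ A` with `x(n') n = n' q(x ⊗ n)` (`exists_pairDual_smul`). An element `z` with `q z = 1` is a
finite dual basis of `N` over `B`, and also shows that every `B`-endomorphism of `N` is right
multiplication by an element of `A`, unique by `pair_toReg_injective`. The values of the functionals
generate `B` additively (`mem_closure_pair`). So `N` is a progenerator over `B` with opposite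
endomorphism ring `A`, and `Hom_B(N, B)` completes it to a nondegenerate context
(`endContext_isNondegenerate`), equivariant by transport of structure.

Conversely, an equivariant context gives the functor `N ⊗_A -`, with quasi-inverse `M ⊗_B -`. If `φ
w = 1` with `w` a sum of tensors `m ⊗ n`, then `x ↦ m ⊗ (n ⊗ x)`, summed over `w`, inverts the
evaluation `M ⊗_B (N ⊗_A X) ⟶ X` (`counit_isIso`). The module structure is `(n ⊗ x) ⊗ v ↦ n ⊗ (x ⊗
v)`. -/

open MulOpposite

noncomputable section

namespace SkewTensor

open scoped ModuleCat

/-! ### `A ∗ G`-modules as `A`-modules with a compatible action of `G`. -/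

section Basics

variable {K : Type u} [Field K] {G : Type v} [Group G]
  {A : Type u} [Ring A] [Algebra K A] [MulSemiringAction G A] [SMulCommClass G K A]

/-- An `A ∗ G`-module is an `A`-module through `a ↦ single 1 a`. -/
instance coeffModule (X : ModuleCat.{u} (SkewMonoidAlgebra A G)) : Module A X :=
  Module.compHom X (SkewMonoidAlgebra.singleOneRingHom : A →+* SkewMonoidAlgebra A G)

theorem single_one_smul {X : ModuleCat.{u} (SkewMonoidAlgebra A G)} (a : A) (x : X) :
    SkewMonoidAlgebra.single (1 : G) a • x = a • x := rfl

/-- `K` acts through `A`, so `K`-linearity and `K`-balancedness become special cases of the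
corresponding statements for `A`. -/
theorem field_smul {X : ModuleCat.{u} (SkewMonoidAlgebra A G)} (k : K) (x : X) :
    k • x = algebraMap K A k • x := rfl

instance coeffTower (X : ModuleCat.{u} (SkewMonoidAlgebra A G)) : IsScalarTower K A X :=
  ⟨fun k a x => by rw [field_smul (A := A), smul_smul, Algebra.smul_def]⟩

/-- The action of a group element on an `A ∗ G`-module. -/
def act {X : ModuleCat.{u} (SkewMonoidAlgebra A G)} (g : G) (x : X) : X :=
  SkewMonoidAlgebra.single g (1 : A) • x

theorem single_smul {X : ModuleCat.{u} (SkewMonoidAlgebra A G)} (g : G) (a : A) (x : X) :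
    SkewMonoidAlgebra.single g a • x = a • act g x := by
  rw [act, ← single_one_smul, smul_smul]; simp

theorem act_smul {X : ModuleCat.{u} (SkewMonoidAlgebra A G)} (g : G) (a : A) (x : X) :
    act g (a • x) = (g • a) • act g x := by
  rw [act, act, ← single_one_smul, ← single_one_smul, smul_smul, smul_smul]; simp

theorem act_mul {X : ModuleCat.{u} (SkewMonoidAlgebra A G)} (g h : G) (x : X) :
    act (g * h) x = act g (act h x) := by
  rw [act, act, act, smul_smul]; simp

@[simp]
theorem act_one {X : ModuleCat.{u} (SkewMonoidAlgebra A G)} (x : X) : act (1 : G) x = x := by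
  rw [act, SkewMonoidAlgebra.single_one_one, one_smul]

theorem act_add {X : ModuleCat.{u} (SkewMonoidAlgebra A G)} (g : G) (x y : X) :
    act g (x + y) = act g x + act g y := smul_add _ _ _

theorem act_act_inv {X : ModuleCat.{u} (SkewMonoidAlgebra A G)} (g : G) (x : X) :
    act g (act g⁻¹ x) = x := by
  rw [← act_mul, mul_inv_cancel, act_one]

/-- The representation of `G` on an `A ∗ G`-module. -/
def resRep (X : ModuleCat.{u} (SkewMonoidAlgebra A G)) : Representation K G X where
  toFun g := Algebra.lsmul K K X (SkewMonoidAlgebra.single g (1 : A))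
  map_one' := LinearMap.ext act_one
  map_mul' g h := LinearMap.ext (act_mul g h)

instance fieldCommClass (X : ModuleCat.{u} (SkewMonoidAlgebra A G)) : SMulCommClass A K X :=
  ⟨fun a k x => by
    rw [field_smul (A := A), field_smul (A := A), smul_smul, smul_smul, Algebra.commutes]⟩

/-- The `G`-module underlying an `A ∗ G`-module. -/
def res (X : ModuleCat.{u} (SkewMonoidAlgebra A G)) : Rep.{u} K G :=
  Rep.of (resRep X)

variable (K) in
/-- The identity, from an `A ∗ G`-module to its underlying `G`-module. -/
def toRes {X : ModuleCat.{u} (SkewMonoidAlgebra A G)} : X ≃ₗ[K] res (K := K) X :=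
  LinearEquiv.refl K X

theorem res_ρ {X : ModuleCat.{u} (SkewMonoidAlgebra A G)} (g : G) (x : X) :
    (res X).ρ g (toRes K x) = toRes K (act g x) := rfl

theorem act_mk {X : ModuleCat.{u} (SkewMonoidAlgebra A G)} {V : Rep.{u} K G} (g : G) (x : X)
    (v : V) : act g (mk x v) = mk (act g x) (V.ρ g v) := single_smul_mk g 1 x v

theorem coeff_smul_mk {X : ModuleCat.{u} (SkewMonoidAlgebra A G)} {V : Rep.{u} K G} (a : A)
    (x : X) (v : V) : a • mk x v = mk (a • x) v := by
  have h := single_smul_mk (1 : G) a x v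
  rwa [map_one] at h

theorem hom_coeff_smul {X Y : ModuleCat.{u} (SkewMonoidAlgebra A G)} (f : X ⟶ Y) (a : A) (x : X) :
    f.hom (a • x) = a • f.hom x := f.hom.map_smul _ _

theorem hom_field_smul {X Y : ModuleCat.{u} (SkewMonoidAlgebra A G)} (f : X ⟶ Y) (k : K) (x : X) :
    f.hom (k • x) = k • f.hom x := f.hom.map_smul _ _

theorem hom_act {X Y : ModuleCat.{u} (SkewMonoidAlgebra A G)} (f : X ⟶ Y) (g : G) (x : X) :
    f.hom (act g x) = act g (f.hom x) := f.hom.map_smul _ _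

/-- A morphism of `A ∗ G`-modules from an additive map commuting with `A` and `G`. -/
def homMk {X Y : ModuleCat.{u} (SkewMonoidAlgebra A G)} (f : X →+ Y)
    (hA : ∀ (a : A) (x : X), f (a • x) = a • f x)
    (hG : ∀ (g : G) (x : X), f (act g x) = act g (f x)) :
    X ⟶ Y :=
  ModuleCat.ofHom (linearMapOfSingle f fun g a x => by rw [single_smul, single_smul, hA, hG])

/-- A morphism out of `X ⊠ V` from a bilinear map that commutes with `A` and `G`. -/
def lift {X Y : ModuleCat.{u} (SkewMonoidAlgebra A G)} {V : Rep.{u} K G} (f : X → V → Y)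
    (add_left : ∀ x y v, f (x + y) v = f x v + f y v)
    (add_right : ∀ x v w, f x (v + w) = f x v + f x w)
    (smul_right : ∀ (k : K) x v, f x (k • v) = k • f x v)
    (hA : ∀ (a : A) x v, f (a • x) v = a • f x v)
    (hG : ∀ (g : G) x v, f (act g x) (V.ρ g v) = act g (f x v)) : obj X V ⟶ Y :=
  -- `K`-homogeneity in the first variable is `hA` at a scalar of `A`, hence not a separate
  -- hypothesis.
  let e : X ⊗[K] V →ₗ[K] Y := TensorProduct.lift
    (LinearMap.mk₂ K f add_left (fun k x v => hA (algebraMap K A k) x v) add_right smul_right)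
  homMk ((e ∘ₗ (objEquiv X V).symm.toLinearMap).toAddMonoidHom)
    (fun a z => by
      induction z using obj_induction with
      | h0 => simp
      | hmk x v => rw [coeff_smul_mk]; exact hA a x v
      | hadd x y hx hy => rw [smul_add, map_add, hx, hy, map_add, smul_add])
    (fun g z => by
      induction z using obj_induction with
      | h0 => simp [act]
      | hmk x v => rw [act_mk]; exact hG g x v
      | hadd x y hx hy => rw [act_add, map_add, hx, hy, map_add, act_add])

@[simp]
theorem lift_mk {X Y : ModuleCat.{u} (SkewMonoidAlgebra A G)} {V : Rep.{u} K G} (f : X → V → Y)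
    (h₁ h₂ h₃ h₄ h₅) (x : X) (v : V) : (lift f h₁ h₂ h₃ h₄ h₅).hom (mk x v) = f x v := rfl

/-- A morphism of `G`-modules from a `K`-linear equivariant map. -/
def repHom {V W : Rep.{u} K G} (f : V →ₗ[K] W) (h : ∀ g v, f (V.ρ g v) = W.ρ g (f v)) : V ⟶ W :=
  Rep.ofHom ⟨f, fun g => LinearMap.ext (h g)⟩

section OfRep

variable (X : Type u) [AddCommGroup X] [Module K X] [Module A X] [IsScalarTower K A X]
  (ρ : Representation K G X) (hρ : ∀ (g : G) (a : A) (x : X), ρ g (a • x) = (g • a) • ρ g x)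

/-- The action of `A ∗ G` on an `A`-module with a compatible action of `G`. -/
def ofRepAction : SkewMonoidAlgebra A G →ₐ[K] Module.End K X :=
  SkewMonoidAlgebra.liftNCAlgHom (Algebra.lsmul K K X) ρ (fun {a g} => by
    ext x
    exact (hρ g a x).symm)

theorem ofRepAction_single (g : G) (a : A) (x : X) :
    ofRepAction X ρ hρ (SkewMonoidAlgebra.single g a) x = a • ρ g x := by
  simp [ofRepAction, SkewMonoidAlgebra.liftNCAlgHom, SkewMonoidAlgebra.liftNCRingHom]

/-- The `A ∗ G`-module given by an `A`-module with a compatible action of `G`. -/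
def ofRep : ModuleCat.{u} (SkewMonoidAlgebra A G) :=
  @ModuleCat.of _ _ X _ (Module.compHom X (ofRepAction X ρ hρ).toRingHom)

/-- The identity between an `A`-module with a compatible action of `G` and its `A ∗ G`-module. -/
def ofRepEquiv : X ≃+ ofRep X ρ hρ := AddEquiv.refl X

theorem smul_ofRepEquiv (a : A) (x : X) :
    a • ofRepEquiv X ρ hρ x = ofRepEquiv X ρ hρ (a • x) :=
  (ofRepAction_single X ρ hρ 1 a x).trans (by rw [map_one]; rfl)

theorem act_ofRepEquiv (g : G) (x : X) :
    act g (ofRepEquiv X ρ hρ x) = ofRepEquiv X ρ hρ (ρ g x) :=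
  (ofRepAction_single X ρ hρ g 1 x).trans (by rw [one_smul]; rfl)

end OfRep

end Basics

end SkewTensor

/-! ### The universal property of `M ⊗_B N`. -/

section BalancedLift

variable {K : Type u} [Field K] {B : Type u} [Ring B]
  {M N P : Type u} [AddCommGroup M] [Module K M] [Module Bᵐᵒᵖ M]
  [AddCommGroup N] [Module K N] [Module B N] [AddCommGroup P] [Module K P]

/-- The linear map on `M ⊗_B N` given by a balanced bilinear map. -/
def BalancedTensor.lift (f : M →ₗ[K] N →ₗ[K] P)
    (hf : ∀ (m : M) (b : B) (n : N), f (op b • m) n = f m (b • n)) :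
    BalancedTensor K B M N →ₗ[K] P :=
  (balancedRelations K B M N).liftQ (TensorProduct.lift f) (by
    rw [balancedRelations, Submodule.span_le]
    rintro _ ⟨m, b, n, rfl⟩
    simp [hf])

@[simp]
theorem BalancedTensor.lift_tmul (f : M →ₗ[K] N →ₗ[K] P)
    (hf : ∀ (m : M) (b : B) (n : N), f (op b • m) n = f m (b • n)) (m : M) (n : N) :
    BalancedTensor.lift f hf (.tmul K B m n) = f m n := by
  simp [BalancedTensor.lift, BalancedTensor.tmul]

variable (K B) in
theorem BalancedTensor.smul_tmul (m : M) (b : B) (n : N) :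
    BalancedTensor.tmul K B (op b • m) n = .tmul K B m (b • n) :=
  (Submodule.Quotient.eq _).2 (Submodule.subset_span ⟨m, b, n, rfl⟩)

variable (K B M N) in
/-- The canonical bilinear map to `M ⊗_B N`. -/
def BalancedTensor.mk : M →ₗ[K] N →ₗ[K] BalancedTensor K B M N :=
  (TensorProduct.mk K M N).compr₂ (balancedRelations K B M N).mkQ

@[simp]
theorem BalancedTensor.mk_apply (m : M) (n : N) :
    BalancedTensor.mk K B M N m n = .tmul K B m n := rfl

@[elab_as_elim]
theorem BalancedTensor.induction {p : BalancedTensor K B M N → Prop}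
    (x : BalancedTensor K B M N) (h0 : p 0) (ht : ∀ m n, p (.tmul K B m n))
    (hadd : ∀ x y, p x → p y → p (x + y)) : p x := by
  obtain ⟨z, rfl⟩ := (balancedRelations K B M N).mkQ_surjective x
  induction z using TensorProduct.induction_on with
  | zero => rwa [map_zero]
  | tmul m n => exact ht m n
  | add x y hx hy => rw [map_add]; exact hadd _ _ hx hy

end BalancedLift

namespace MoritaContext

/-! ### Nondegeneracy of a Morita context from `1` lying in both images. -/

section Symm

variable {K : Type u} [Field K] {A B : Type u} [Ring A] [Algebra K A] [Ring B] [Algebra K B]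

/-- The Morita context with the two bimodules exchanged. -/
@[reducible]
def symm (C : MoritaContext K A B) : MoritaContext K B A where
  M := C.N
  N := C.M
  φ := C.ψ
  ψ := C.φ
  φ_left := C.ψ_left
  φ_right := C.ψ_right
  ψ_left := C.φ_left
  ψ_right := C.φ_right
  φ_smul := C.ψ_smul
  ψ_smul := C.φ_smul

/-- Left multiplication by `a` on `M ⊗_B N`. -/
def leftMul (C : MoritaContext K A B) (a : A) :
    BalancedTensor K B C.M C.N →ₗ[K] BalancedTensor K B C.M C.N :=
  BalancedTensor.lift ((BalancedTensor.mk K B C.M C.N).comp (Algebra.lsmul K K C.M a))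
    (fun m b n => by simp [smul_comm a, BalancedTensor.smul_tmul])

theorem leftMul_tmul (C : MoritaContext K A B) (a : A) (m : C.M) (n : C.N) :
    C.leftMul a (.tmul K B m n) = .tmul K B (a • m) n :=
  BalancedTensor.lift_tmul _ _ _ _

theorem leftMul_add (C : MoritaContext K A B) (a b : A) (x : BalancedTensor K B C.M C.N) :
    C.leftMul (a + b) x = C.leftMul a x + C.leftMul b x := by
  induction x using BalancedTensor.induction with
  | h0 => simp
  | ht m n =>
    rw [leftMul_tmul, leftMul_tmul, leftMul_tmul, add_smul]
    exact LinearMap.map_add₂ (BalancedTensor.mk K B C.M C.N) _ _ _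
  | hadd x y hx hy => simp only [map_add, hx, hy]; abel

theorem leftMul_zero (C : MoritaContext K A B) (x : BalancedTensor K B C.M C.N) :
    C.leftMul 0 x = 0 := by
  simpa using C.leftMul_add 0 0 x

/-- The identity `φ(x) y = x φ(y)` in `M ⊗_B N`, with `r` the right multiplication by `φ(y)`. On
pure tensors, `φ(m ⊗ n) m' ⊗ n' = m ψ(n ⊗ m') ⊗ n' = m ⊗ ψ(n ⊗ m') n' = m ⊗ n φ(m' ⊗ n')`. -/
theorem exists_eq_leftMul (C : MoritaContext K A B) (y : BalancedTensor K B C.M C.N) :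
    ∃ r : BalancedTensor K B C.M C.N →ₗ[K] BalancedTensor K B C.M C.N,
      (∀ x, r x = C.leftMul (C.φ x) y) ∧
      ∀ m n, r (.tmul K B m n) = .tmul K B m (op (C.φ y) • n) := by
  induction y using BalancedTensor.induction with
  | h0 => exact ⟨0, by simp, fun m n => by simp [← BalancedTensor.mk_apply]⟩
  | ht m' n' =>
    let r := BalancedTensor.lift ((BalancedTensor.mk K B C.M C.N).compl₂
      (Algebra.lsmul K K C.N (op (C.φ (.tmul K B m' n'))))) (fun m b n => by
        simp only [LinearMap.compl₂_apply, BalancedTensor.mk_apply, Algebra.lsmul_coe]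
        rw [BalancedTensor.smul_tmul, smul_comm])
    have hr : ∀ m n, r (.tmul K B m n) = .tmul K B m (op (C.φ (.tmul K B m' n')) • n) :=
      fun m n => BalancedTensor.lift_tmul _ _ _ _
    refine ⟨r, fun x => ?_, hr⟩
    induction x using BalancedTensor.induction with
    | h0 => rw [map_zero, map_zero, leftMul_zero]
    | ht m n =>
      rw [hr, leftMul_tmul, ← C.ψ_smul, ← BalancedTensor.smul_tmul, C.φ_smul]
    | hadd x y hx hy => rw [map_add, hx, hy, map_add, leftMul_add]
  | hadd y z hy hz =>
    obtain ⟨r, hr, hr'⟩ := hy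
    obtain ⟨s, hs, hs'⟩ := hz
    refine ⟨r + s, fun x => by simp [hr, hs], fun m n => ?_⟩
    rw [LinearMap.add_apply, hr', hs', map_add, MulOpposite.op_add, add_smul]
    exact ((BalancedTensor.mk K B C.M C.N m).map_add _ _).symm

/-- If `φ(y) = 1` and `φ(x) = 0`, then `x = x φ(y) = φ(x) y = 0`. -/
theorem φ_injective (C : MoritaContext K A B) (h : Function.Surjective C.φ) :
    Function.Injective C.φ := by
  refine (injective_iff_map_eq_zero _).2 fun x hx => ?_
  obtain ⟨y, hy⟩ := h 1
  obtain ⟨r, hr, hr'⟩ := C.exists_eq_leftMul y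
  have hid : r x = x := by
    clear hx
    induction x using BalancedTensor.induction with
    | h0 => exact map_zero r
    | ht m n => rw [hr', hy, op_one, one_smul]
    | hadd x z hx hz => rw [map_add, hx, hz]
  rw [← hid, hr, hx, leftMul_zero]

theorem φ_leftMul (C : MoritaContext K A B) (a : A) (x : BalancedTensor K B C.M C.N) :
    C.φ (C.leftMul a x) = a * C.φ x := by
  induction x using BalancedTensor.induction with
  | h0 => simp
  | ht m n => rw [leftMul_tmul, C.φ_left]
  | hadd x y hx hy => rw [map_add, map_add, hx, hy, map_add, mul_add]

/-- The image of `φ` is a left ideal. -/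
theorem φ_surjective (C : MoritaContext K A B) (h : ∃ x, C.φ x = 1) : Function.Surjective C.φ := by
  obtain ⟨x, hx⟩ := h
  intro a
  refine ⟨C.leftMul a x, ?_⟩
  rw [φ_leftMul, hx, mul_one]

/-- A Morita context is nondegenerate if `1` is in the images of `φ` and `ψ`. -/
theorem isNondegenerate_of_exists (C : MoritaContext K A B) (hφ : ∃ x, C.φ x = 1)
    (hψ : ∃ x, C.ψ x = 1) : C.IsNondegenerate :=
  ⟨⟨C.φ_injective (C.φ_surjective hφ), C.φ_surjective hφ⟩,
    ⟨C.symm.φ_injective (C.symm.φ_surjective hψ), C.symm.φ_surjective hψ⟩⟩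

end Symm

/-! ### The Morita context of a bimodule and its dual. -/

section Endomorphisms

variable {K : Type u} [Field K] {A B : Type u} [Ring A] [Algebra K A] [Ring B] [Algebra K B]
  {N : Type u} [AddCommGroup N] [Module K N] [Module B N] [Module Aᵐᵒᵖ N] [SMulCommClass B Aᵐᵒᵖ N]
  [IsScalarTower K B N] [IsScalarTower K Aᵐᵒᵖ N]

variable (B N) in
/-- The right action of `a` on a `B`-`A`-bimodule, as a `B`-linear map. -/
def rightMul (a : A) : N →ₗ[B] N where
  toFun n := op a • n
  map_add' := smul_add _
  map_smul' b n := (smul_comm b (op a) n).symm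

variable (A B N) in
/-- The `A`-module structure on the `B`-linear dual of a `B`-`A`-bimodule. -/
@[reducible]
def dualModule : Module A (N →ₗ[B] B) where
  smul a m := m ∘ₗ rightMul B N a
  one_smul m := by ext n; change m (op (1 : A) • n) = m n; rw [op_one, one_smul]
  mul_smul a b m := by ext n; change m (op (a * b) • n) = m (op b • op a • n); rw [op_mul, mul_smul]
  smul_zero a := rfl
  smul_add a m m' := rfl
  add_smul a b m := by
    ext n; change m (op (a + b) • n) = m (op a • n) + m (op b • n)
    rw [MulOpposite.op_add, add_smul, map_add]
  zero_smul m := by ext n; change m (op (0 : A) • n) = 0; rw [op_zero, zero_smul, map_zero]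

/-- The Morita context of a `B`-`A`-bimodule `N` for which `A` is the opposite endomorphism ring of
the `B`-module `N`. -/
def endContext (e : ∀ f : N →ₗ[B] N, ∃! a : A, ∀ n, f n = op a • n) : MoritaContext K A B :=
  letI := dualModule A B N
  have smul_def (a : A) (m : N →ₗ[B] B) (n : N) : (a • m) n = m (op a • n) := rfl
  have op_def (b : B) (m : N →ₗ[B] B) (n : N) : (op b • m) n = m n * b := rfl
  -- The element of `A` acting on `N` as the rank-one endomorphism `n' ↦ m(n') n`; this will be `φ(m
  -- ⊗ n)`.
  let e' (m : N →ₗ[B] B) (n : N) : A := (e (m.smulRight n)).choose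
  have he (m : N →ₗ[B] B) (n n' : N) : op (e' m n) • n' = m n' • n :=
    ((e (m.smulRight n)).choose_spec.1 n').symm
  -- By uniqueness in `e`, `A` acts faithfully on `N`, so identities in `A` can be checked on `N`.
  have eq {a b : A} (h : ∀ n : N, op a • n = op b • n) : a = b :=
    (e (rightMul B N a)).unique (fun n => rfl) h
  { M := N →ₗ[B] B
    N := N
    bimoduleM := ⟨fun a b m => rfl⟩
    leftTowerM := ⟨fun k a m => by
      ext n
      rw [smul_def, op_smul, smul_assoc, LinearMap.smul_apply, smul_def]
      rw [← one_smul B (op a • n), ← smul_assoc, map_smul, one_smul, smul_assoc, one_smul]⟩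
    rightTowerM := ⟨fun k b m => by
      ext n
      induction b with | _ b
      rw [← op_smul, op_def, LinearMap.smul_apply, op_def, Algebra.mul_smul_comm]⟩
    φ := BalancedTensor.lift
      (LinearMap.mk₂ K e'
        (fun m m' n => eq fun n' => by
          rw [MulOpposite.op_add, add_smul, he, he, he, LinearMap.add_apply, add_smul])
        (fun k m n => eq fun n' => by
          rw [op_smul, smul_assoc, he, he, LinearMap.smul_apply, smul_assoc])
        (fun m n n₁ => eq fun n' => by rw [MulOpposite.op_add, add_smul, he, he, he, smul_add])
        (fun k m n => eq fun n' => by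
          rw [op_smul, smul_assoc, he, he, ← algebraMap_smul B k n,
            ← algebraMap_smul B k (m n' • n),
            smul_smul, smul_smul, Algebra.commutes]))
      (fun m b n => eq fun n' => by
        change op (e' (op b • m) n) • n' = op (e' m (b • n)) • n'
        rw [he, he, op_def, mul_smul])
    ψ := BalancedTensor.lift
      (LinearMap.mk₂ K (fun n m => m n)
        (fun n n' m => map_add m n n')
        (fun k n m => by
          rw [← one_smul B n, ← smul_assoc, map_smul, one_smul, smul_assoc, one_smul])
        (fun n m m' => rfl)
        (fun k n m => rfl))
      (fun n a m => (smul_def a m n).symm)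
    φ_left := fun a m n => eq fun n' => by
      change op (e' (a • m) n) • n' = op (a * e' m n) • n'
      rw [op_mul, mul_smul, he, he, smul_def]
    φ_right := fun a m n => eq fun n' => by
      change op (e' m (op a • n)) • n' = op (e' m n * a) • n'
      rw [op_mul, mul_smul, he, he, smul_comm]
    ψ_left := fun b n m => m.map_smul b n
    ψ_right := fun b n m => rfl
    φ_smul := fun m n m' => by
      ext n'
      change m' (op (e' m n) • n') = m n' * m' n
      rw [he]
      exact m'.map_smul _ _
    ψ_smul := fun n m n' => (he m n' n).symm }

variable (e : ∀ f : N →ₗ[B] N, ∃! a : A, ∀ n, f n = op a • n)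

theorem endContext_φ_smul (m : N →ₗ[B] B) (n n' : N) :
    op ((endContext e).φ (.tmul K B m n)) • n' = m n' • n :=
  ((e (m.smulRight n)).choose_spec.1 n').symm

theorem endContext_ψ (m : N →ₗ[B] B) (n : N) :
    (endContext (K := K) e).ψ (.tmul K A n m) = m n := rfl

theorem eq_of_op_smul_eq (e : ∀ f : N →ₗ[B] N, ∃! a : A, ∀ n, f n = op a • n)
    {a b : A} (h : ∀ n : N, op a • n = op b • n) : a = b :=
  (e (rightMul B N a)).unique (fun _ => rfl) h

/-- The first hypothesis is the dual basis criterion (`N` is finitely generated projective over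
`B`), the second says that `N` is a generator. Rank-one endomorphisms are the actions of the values
of `φ` on pure tensors, and evaluations are those of `ψ`, so both maps hit `1`. -/
theorem endContext_isNondegenerate
    (hφ : LinearMap.id ∈ AddSubmonoid.closure {f : N →ₗ[B] N |
      ∃ (m : N →ₗ[B] B) (n : N), f = m.smulRight n})
    (hψ : 1 ∈ AddSubmonoid.closure {b : B | ∃ (m : N →ₗ[B] B) (n : N), b = m n}) :
    (endContext (K := K) e).IsNondegenerate := by
  refine isNondegenerate_of_exists _ ?_ ?_
  · suffices ∃ x, ∀ n, (LinearMap.id : N →ₗ[B] N) n = op ((endContext (K := K) e).φ x) • n by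
      obtain ⟨x, hx⟩ := this
      exact ⟨x, eq_of_op_smul_eq e fun n => by rw [← hx, op_one, one_smul]; rfl⟩
    generalize (LinearMap.id : N →ₗ[B] N) = f at hφ ⊢
    induction hφ using AddSubmonoid.closure_induction with
    | mem f hf =>
      obtain ⟨m, n, rfl⟩ := hf
      exact ⟨.tmul K B m n, fun n' => (endContext_φ_smul e m n n').symm⟩
    | zero => exact ⟨0, fun n => by rw [map_zero, op_zero, zero_smul]; rfl⟩
    | add f f' _ _ hf hf' =>
      obtain ⟨x, hx⟩ := hf
      obtain ⟨x', hx'⟩ := hf'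
      exact ⟨x + x', fun n => by
        rw [map_add, MulOpposite.op_add, add_smul, ← hx, ← hx', LinearMap.add_apply]⟩
  · generalize (1 : B) = b at hψ ⊢
    induction hψ using AddSubmonoid.closure_induction with
    | mem b hb =>
      obtain ⟨m, n, rfl⟩ := hb
      exact ⟨.tmul K A n m, endContext_ψ e m n⟩
    | zero => exact ⟨0, map_zero _⟩
    | add b b' _ _ hb hb' =>
      obtain ⟨x, hx⟩ := hb
      obtain ⟨x', hx'⟩ := hb'
      exact ⟨x + x', by rw [map_add, hx, hx']⟩

/-! ### Equivariance of the context of a bimodule. -/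

section Equivariant

variable {G : Type v} [Group G] [MulSemiringAction G A] [MulSemiringAction G B]
  [SMulCommClass G K B] (ρ : Representation K G N)
  (hρ : ∀ (g : G) (b : B) (n : N) (a : A), ρ g (b • op a • n) = (g • b) • op (g • a) • ρ g n)

/-- The action of `G` on the dual of an equivariant bimodule. -/
def dualRep (hB : ∀ (g : G) (b : B) (n : N), ρ g (b • n) = (g • b) • ρ g n) :
    Representation K G (N →ₗ[B] B) where
  toFun g :=
    { toFun := fun m =>
        { toFun := fun n => g • m (ρ g⁻¹ n)
          map_add' := fun n n' => by rw [map_add, map_add, smul_add]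
          map_smul' := fun b n => by
            rw [hB, map_smul, smul_eq_mul, smul_mul', smul_inv_smul]; rfl }
      map_add' := fun m m' => by ext n; exact smul_add _ _ _
      map_smul' := fun k m => by ext n; exact smul_comm _ _ _ }
  map_one' := by ext m n; simp
  map_mul' g h := by ext m n; simp [mul_smul]

/-- The equivariant structure on the Morita context of an equivariant bimodule. -/
def endContextGStructure : (endContext (K := K) e).GStructure G :=
  have hB (g : G) (b : B) (n : N) : ρ g (b • n) = (g • b) • ρ g n := by
    simpa using hρ g b n 1
  have hA (g : G) (a : A) (n : N) : ρ g (op a • n) = op (g • a) • ρ g n := by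
    simpa using hρ g 1 n a
  { ρM := dualRep ρ hB
    ρN := ρ
    ρM_smul := fun g a (m : N →ₗ[B] B) b => by
      refine LinearMap.ext fun n => ?_
      change g • (m (op a • ρ g⁻¹ n) * b) = (g • m (ρ g⁻¹ (op (g • a) • n))) * g • b
      rw [hA, inv_smul_smul, smul_mul']
    ρN_smul := hρ
    φ_equivariant := fun g (m : N →ₗ[B] B) (n : N) => eq_of_op_smul_eq e fun n' => by
      refine (endContext_φ_smul e (dualRep ρ hB g m) (ρ g n) n').trans ?_
      change (g • m (ρ g⁻¹ n')) • ρ g n = _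
      -- After this substitution the claim reads `(g • m(n₁)) • g n = g (m(n₁) • n)`, as the inverse
      -- in the action on the dual cancels.
      obtain ⟨n', rfl⟩ : ∃ n₁, n' = ρ g n₁ := ⟨ρ g⁻¹ n', by simp⟩
      refine Eq.trans ?_ (hA _ _ _)
      rw [endContext_φ_smul, hB]
      simp
    ψ_equivariant := fun g (n : N) (m : N →ₗ[B] B) => by
      change g • m (ρ g⁻¹ (ρ g n)) = g • m n
      simp }

end Equivariant

end Endomorphisms

end MoritaContext

namespace SkewTensor

open scoped ModuleCat

/-! ### The `A ∗ G`-module `A`, and morphisms out of the induced modules `A ⊠ V`. -/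

section Regular

variable (K : Type u) [Field K] (G : Type v) [Group G]
  (A : Type u) [Ring A] [Algebra K A] [MulSemiringAction G A] [SMulCommClass G K A]

/-- The action of `G` on a `G`-algebra, as a representation. -/
def algRep : Representation K G A where
  toFun g := { toFun := fun a => g • a, map_add' := smul_add g, map_smul' := smul_comm g }
  map_one' := LinearMap.ext (one_smul G)
  map_mul' g h := LinearMap.ext (mul_smul g h)

/-- The `A ∗ G`-module `A`, with `A` acting by left multiplication. -/
def reg : ModuleCat.{u} (SkewMonoidAlgebra A G) :=
  ofRep A (algRep K G A) (fun g a x => smul_mul' g a x)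

/-- The identity from `A` to the `A ∗ G`-module `A`. -/
def toReg : A ≃+ reg K G A := ofRepEquiv A (algRep K G A) _

variable {K G A}

theorem smul_toReg (a x : A) : a • toReg K G A x = toReg K G A (a * x) :=
  smul_ofRepEquiv A _ _ a x

theorem act_toReg (g : G) (x : A) : act g (toReg K G A x) = toReg K G A (g • x) :=
  act_ofRepEquiv A _ _ g x

theorem toReg_smul (k : K) (x : A) : toReg K G A (k • x) = k • toReg K G A x := by
  rw [field_smul (A := A), smul_toReg, Algebra.smul_def]

theorem smul_reg (a : A) (x : reg K G A) :
    (toReg K G A).symm (a • x) = a * (toReg K G A).symm x := by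
  obtain ⟨x, rfl⟩ := (toReg K G A).surjective x
  rw [smul_toReg]; simp

theorem act_reg (g : G) (x : reg K G A) :
    (toReg K G A).symm (act g x) = g • (toReg K G A).symm x := by
  obtain ⟨x, rfl⟩ := (toReg K G A).surjective x
  rw [act_toReg]; simp

/-- The morphism `A ⊠ V ⟶ X` determined by a morphism of `G`-modules `V ⟶ X`. -/
def regLift {V : Rep.{u} K G} {X : ModuleCat.{u} (SkewMonoidAlgebra A G)} (f : V ⟶ res X) :
    obj (reg K G A) V ⟶ X :=
  lift (fun a v => (toReg K G A).symm a • (toRes K).symm (f.hom v))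
    (fun a b v => by rw [map_add, add_smul])
    (fun a v w => by rw [map_add, map_add, smul_add])
    (fun k a v => by rw [map_smul, map_smul, smul_comm])
    (fun a b v => by rw [smul_reg, mul_smul])
    (fun g a v => by
      rw [act_reg, act_smul, Rep.hom_comm_apply]; rfl)

theorem regLift_mk {V : Rep.{u} K G} {X : ModuleCat.{u} (SkewMonoidAlgebra A G)} (f : V ⟶ res X)
    (a : A) (v : V) :
    (regLift f).hom (mk (toReg K G A a) v) = a • (toRes K).symm (f.hom v) := by
  rw [regLift, lift_mk, AddEquiv.symm_apply_apply]

theorem regLift_id_mk {X : ModuleCat.{u} (SkewMonoidAlgebra A G)} (a : A) (x : X) :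
    (regLift (𝟙 (res X))).hom (mk (toReg K G A a) (toRes K x)) = a • x :=
  regLift_mk _ a (toRes K x)

/-- The morphism of `G`-modules `v ↦ f (1 ⊗ v)`. -/
def regRestrict {V : Rep.{u} K G} {X : ModuleCat.{u} (SkewMonoidAlgebra A G)}
    (f : obj (reg K G A) V ⟶ X) : V ⟶ res X :=
  repHom (V := V) (W := res X)
    ({ toFun := fun v => f.hom (mk (toReg K G A 1) v)
       map_add' := fun v w => by rw [mk_add, map_add]
       map_smul' := fun k v => by rw [mk_smul, hom_field_smul]; rfl } : V →ₗ[K] X)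
    (fun g v => by
      change f.hom (mk (toReg K G A 1) (V.ρ g v)) = act g (f.hom (mk (toReg K G A 1) v))
      rw [← hom_act, act_mk, act_toReg, smul_one])

theorem regRestrict_hom {V : Rep.{u} K G} {X : ModuleCat.{u} (SkewMonoidAlgebra A G)}
    (f : obj (reg K G A) V ⟶ X) (v : V) :
    (regRestrict f).hom v = toRes K (f.hom (mk (toReg K G A 1) v)) := rfl

/-- The elements `1 ⊗ v` generate `A ⊠ V` over `A`. -/
theorem hom_ext_reg {V : Rep.{u} K G} {X : ModuleCat.{u} (SkewMonoidAlgebra A G)}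
    {f f' : obj (reg K G A) V ⟶ X}
    (h : ∀ v, f.hom (mk (toReg K G A 1) v) = f'.hom (mk (toReg K G A 1) v)) : f = f' := by
  refine hom_ext fun a v => ?_
  obtain ⟨a, rfl⟩ := (toReg K G A).surjective a
  rw [← mul_one a, ← smul_toReg, ← coeff_smul_mk, hom_coeff_smul, hom_coeff_smul, h]

end Regular

/-! ### From a module equivalence `F` to the Morita context of `N = F A`. -/

section Functor

open Functor.LaxRightLinear Functor.OplaxRightLinear

variable {K : Type u} [Field K] {G : Type v} [Group G] {A B : Type u}
    [Ring A] [Algebra K A] [MulSemiringAction G A] [SMulCommClass G K A]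
    [Ring B] [Algebra K B] [MulSemiringAction G B] [SMulCommClass G K B]
  (F : ModuleCat.{u} (SkewMonoidAlgebra A G) ⥤ ModuleCat.{u} (SkewMonoidAlgebra B G))
  [F.RightLinear (Rep.{u} K G)]

/-- The structure morphism `F X ⊠ V ⟶ F (X ⊠ V)` of a module functor. -/
def mu (X : ModuleCat.{u} (SkewMonoidAlgebra A G)) (V : Rep.{u} K G) :
    obj (F.obj X) V ⟶ F.obj (obj X V) :=
  μᵣ F X V

instance (X : ModuleCat.{u} (SkewMonoidAlgebra A G)) (V : Rep.{u} K G) : IsIso (mu F X V) :=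
  inferInstanceAs (IsIso (μᵣ F X V))

theorem mu_surjective (X : ModuleCat.{u} (SkewMonoidAlgebra A G)) (V : Rep.{u} K G) :
    Function.Surjective (mu F X V).hom :=
  (ConcreteCategory.bijective_of_isIso (mu F X V)).2

theorem mu_map {X Y : ModuleCat.{u} (SkewMonoidAlgebra A G)} {V W : Rep.{u} K G} (f : X ⟶ Y)
    (h : V ⟶ W) (y : F.obj X) (v : V) :
    (F.map (map f h)).hom ((mu F X V).hom (mk y v)) =
      (mu F Y W).hom (mk ((F.map f).hom y) (h.hom v)) := by
  have h₁ := congrArg (fun t => t.hom (mk y v)) (μᵣ_naturality_left F f V)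
  have h₂ := congrArg (fun t => t.hom (mk ((F.map f).hom y) v)) (μᵣ_naturality_right F Y h)
  have h₃ : map f h = map f (𝟙 V) ≫ map (𝟙 Y) h := hom_ext fun _ _ => rfl
  rw [h₃, F.map_comp]
  exact (congrArg (F.map (map (𝟙 Y) h)).hom h₁.symm).trans h₂.symm

theorem mu_assoc {X : ModuleCat.{u} (SkewMonoidAlgebra A G)} {V W : Rep.{u} K G}
    (y : F.obj X) (v : V) (w : W) :
    (mu F (obj X V) W).hom (mk ((mu F X V).hom (mk y v)) w) =
      (F.map (assocIso X V W).hom).hom ((mu F X (V ⊗ W)).hom (mk (V := V ⊗ W) y (v ⊗ₜ[K] w))) :=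
  (congrArg (fun t => t.hom (mk (V := V ⊗ W) y (v ⊗ₜ[K] w))) (μᵣ_associativity F X V W)).symm

theorem mu_unit {X : ModuleCat.{u} (SkewMonoidAlgebra A G)} (y : F.obj X) :
    (F.map (unitIso (K := K) X).hom).hom
      ((mu F X (𝟙_ (Rep.{u} K G))).hom (mk (V := 𝟙_ (Rep.{u} K G)) y (1 : K))) = y := by
  have h : mu F X (𝟙_ (Rep.{u} K G)) ≫ F.map (unitIso (K := K) X).hom =
    (unitIso (K := K) (F.obj X)).hom := (μᵣ_unitality F X).symm
  rw [← ModuleCat.comp_apply, h, unitIso_hom_mk, one_smul]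

variable {F} (K) in
/-- The pairing `F A × X → F X`, `(n, x) ↦ F (a ↦ a x) n`. -/
def pair {X : ModuleCat.{u} (SkewMonoidAlgebra A G)} (n : F.obj (reg K G A)) (x : X) : F.obj X :=
  (F.map (regLift (𝟙 (res X)))).hom ((mu F (reg K G A) (res X)).hom (mk n (toRes K x)))

/-- By the universal property of induced modules, `f` factors as `A ⊠ V ⟶ A ⊠ X ⟶ X` through `v ↦
f(1 ⊗ v)`, and `mu` is natural in `V`. The other rules for `pair` that involve morphisms, `mu` or
the right action reduce to evaluating some morphism at `1 ⊗ v`. -/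
theorem pair_eq {V : Rep.{u} K G} {X : ModuleCat.{u} (SkewMonoidAlgebra A G)}
    (f : obj (reg K G A) V ⟶ X) (n : F.obj (reg K G A)) (v : V) :
    (F.map f).hom ((mu F (reg K G A) V).hom (mk n v)) =
      pair K n (f.hom (mk (toReg K G A 1) v)) := by
  have h : f = map (𝟙 _) (regRestrict f) ≫ regLift (𝟙 (res X)) := hom_ext_reg fun v => by
    rw [ModuleCat.comp_apply, map_mk, regRestrict_hom, ModuleCat.id_apply, regLift_id_mk, one_smul]
  conv_lhs => rw [h, F.map_comp, ModuleCat.comp_apply, mu_map, F.map_id]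
  rfl

theorem map_pair {X Y : ModuleCat.{u} (SkewMonoidAlgebra A G)} (f : X ⟶ Y)
    (n : F.obj (reg K G A)) (x : X) : (F.map f).hom (pair K n x) = pair K n (f.hom x) := by
  rw [pair, ← ModuleCat.comp_apply, ← F.map_comp, pair_eq, ModuleCat.comp_apply, regLift_id_mk,
    one_smul]

/-- Associativity of `mu` rewrites the left side as `F` of a morphism `A ⊠ (X ⊗ V) ⟶ X ⊠ V` which
sends `1 ⊗ (x ⊗ v)` to `x ⊗ v`. -/
theorem mu_pair {X : ModuleCat.{u} (SkewMonoidAlgebra A G)} {V : Rep.{u} K G}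
    (n : F.obj (reg K G A)) (x : X) (v : V) :
    (mu F X V).hom (mk (pair K n x) v) = pair K n (mk x v) := by
  have h := mu_map F (regLift (𝟙 (res X))) (𝟙 V)
    ((mu F (reg K G A) (res X)).hom (mk n (toRes K x))) v
  refine h.symm.trans ?_
  rw [mu_assoc, ← ModuleCat.comp_apply, ← F.map_comp, pair_eq, ModuleCat.comp_apply,
    assocIso_hom_mk, map_mk, regLift_id_mk, one_smul]
  rfl

theorem pair_toReg_one (n : F.obj (reg K G A)) : pair K n (toReg K G A 1) = n := by
  conv_rhs => rw [← mu_unit (K := K) F n, pair_eq, unitIso_hom_mk, one_smul]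

/-- Since `a x` is the image of `a ⊗ x` under `A ⊠ X ⟶ X`, this follows from `mu_pair` and
naturality. For `X = A` it is associativity of the right action on `F A`. -/
theorem pair_smul {X : ModuleCat.{u} (SkewMonoidAlgebra A G)}
    (n : F.obj (reg K G A)) (a : A) (x : X) :
    pair K n (a • x) = pair K (pair K n (toReg K G A a)) x := by
  conv_rhs => rw [pair]
  rw [mu_pair, map_pair, regLift_id_mk]

theorem pair_add {X : ModuleCat.{u} (SkewMonoidAlgebra A G)}
    (n : F.obj (reg K G A)) (x y : X) : pair K n (x + y) = pair K n x + pair K n y := by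
  rw [pair, pair, pair, ← map_add, ← map_add, ← mk_add, ← map_add]

theorem add_pair {X : ModuleCat.{u} (SkewMonoidAlgebra A G)}
    (n n' : F.obj (reg K G A)) (x : X) : pair K (n + n') x = pair K n x + pair K n' x := by
  rw [pair, pair, pair, ← map_add, ← map_add, ← add_mk]

theorem pair_zero {X : ModuleCat.{u} (SkewMonoidAlgebra A G)} (n : F.obj (reg K G A)) :
    pair K n (0 : X) = 0 := by
  rw [pair, map_zero, mk_zero, map_zero, map_zero]

theorem zero_pair {X : ModuleCat.{u} (SkewMonoidAlgebra A G)} (x : X) :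
    pair K (0 : F.obj (reg K G A)) x = 0 := by
  rw [pair, zero_mk, map_zero, map_zero]

theorem smul_pair {X : ModuleCat.{u} (SkewMonoidAlgebra A G)}
    (b : B) (n : F.obj (reg K G A)) (x : X) : pair K (b • n) x = b • pair K n x := by
  rw [pair, pair, ← hom_coeff_smul, ← hom_coeff_smul, coeff_smul_mk]

theorem pair_field_smul {X : ModuleCat.{u} (SkewMonoidAlgebra A G)}
    (k : K) (n : F.obj (reg K G A)) (x : X) : pair K n (k • x) = k • pair K n x := by
  rw [pair, pair, ← hom_field_smul, ← hom_field_smul, ← mk_smul, map_smul]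

theorem act_pair {X : ModuleCat.{u} (SkewMonoidAlgebra A G)}
    (g : G) (n : F.obj (reg K G A)) (x : X) :
    act g (pair K n x) = pair K (act g n) (act g x) := by
  rw [pair, pair, ← hom_act, ← hom_act, act_mk, res_ρ]

/-- The action `A ⊠ X ⟶ X` is an epimorphism, `F` preserves it, and `mu` is onto. -/
theorem mem_closure_pair [F.IsEquivalence] {X : ModuleCat.{u} (SkewMonoidAlgebra A G)}
    (y : F.obj X) :
    y ∈ AddSubmonoid.closure {y | ∃ (n : F.obj (reg K G A)) (x : X), y = pair K n x} := by
  have hepi : Epi (regLift (K := K) (𝟙 (res X))) := by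
    refine (ModuleCat.epi_iff_surjective _).2 fun x => ⟨mk (toReg K G A 1) (toRes K x), ?_⟩
    rw [regLift_id_mk, one_smul]
  have hF : Epi (F.map (regLift (K := K) (𝟙 (res X)))) := inferInstance
  obtain ⟨w, rfl⟩ := (ModuleCat.epi_iff_surjective _).1 hF y
  obtain ⟨z, rfl⟩ := mu_surjective F _ _ w
  induction z using obj_induction with
  | h0 => rw [map_zero, map_zero]; exact zero_mem _
  | hmk n v =>
    obtain ⟨x, rfl⟩ := (toRes K).surjective v
    exact AddSubmonoid.subset_closure ⟨n, x, rfl⟩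
  | hadd z z' hz hz' => rw [map_add, map_add]; exact add_mem hz hz'

variable (K) in
/-- The right action of `A` on `F A`. -/
@[reducible]
def rightModule : Module Aᵐᵒᵖ (F.obj (reg K G A)) where
  smul a n := pair K n (toReg K G A a.unop)
  one_smul n := pair_toReg_one F n
  mul_smul a b n := by
    change pair K n (toReg K G A (b.unop * a.unop)) = _
    rw [← smul_toReg, pair_smul]; rfl
  smul_zero a := zero_pair F _
  smul_add a n n' := add_pair F n n' _
  add_smul a b n := by
    change pair K n (toReg K G A (a.unop + b.unop)) = _
    rw [map_add, pair_add]; rfl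
  zero_smul n := (congrArg _ (map_zero _)).trans (pair_zero F n)

/-- The annihilator `V` of `F A` in `A` is a `G`-submodule, so its inclusion extends to a morphism
`A ⊠ V ⟶ A`. By `pair_eq`, `F` sends that morphism and the zero morphism to the same map;
faithfulness of `F` then forces the inclusion to vanish. -/
theorem pair_toReg_injective [F.IsEquivalence] {a : A}
    (h : ∀ n : F.obj (reg K G A), pair K n (toReg K G A a) = 0) : a = 0 := by
  let V : Submodule K A :=
    { carrier := {a | ∀ n : F.obj (reg K G A), pair K n (toReg K G A a) = 0}
      add_mem' := fun ha hb n => by rw [map_add, pair_add, ha, hb, add_zero]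
      zero_mem' := fun n => by rw [map_zero, pair_zero]
      smul_mem' := fun k a ha n => by rw [toReg_smul, pair_field_smul, ha, smul_zero] }
  -- `n (g x) = g ((g⁻¹ n) x) = 0`.
  have hV (g : G) (x : A) (hx : x ∈ V) : g • x ∈ V := fun n => by
    rw [← act_toReg, ← act_act_inv g n, ← act_pair, hx, act, smul_zero]
  let ρ : Representation K G V :=
    { toFun := fun g => (algRep K G A g).restrict (hV g)
      map_one' := by ext x; exact one_smul G (x : A)
      map_mul' := fun g g' => by ext x; exact mul_smul g g' (x : A) }
  let j : Rep.of ρ ⟶ res (reg K G A) := repHom (V := Rep.of ρ) (W := res (reg K G A))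
    ({ toFun := fun x => toReg K G A x.1
       map_add' := fun x y => map_add _ _ _
       map_smul' := fun k x => toReg_smul _ _ } : V →ₗ[K] reg K G A)
    (fun g x => (act_toReg g x.1).symm)
  have hj (x : V) : (regLift j).hom (mk (toReg K G A 1) x) = toReg K G A x.1 :=
    (regLift_mk j 1 x).trans (one_smul _ _)
  have hj' : F.map (regLift j) = F.map (regLift (0 : Rep.of ρ ⟶ res (reg K G A))) := by
    rw [← cancel_epi (mu F _ _)]
    refine hom_ext fun n x => ?_
    rw [ModuleCat.comp_apply, ModuleCat.comp_apply, pair_eq, pair_eq, hj, x.2, regLift_mk, one_smul]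
    exact ((zero_mem V : (0 : A) ∈ V) n).symm
  have hj'' := hj ⟨a, h⟩
  rw [F.map_injective hj', regLift_mk, one_smul] at hj''
  exact (toReg K G A).injective (hj''.symm.trans (map_zero _).symm)

variable (K) in
/-- The functional `n ↦ i (pair n x)` on `F A`. -/
def pairDual {X : ModuleCat.{u} (SkewMonoidAlgebra A G)} (i : F.obj X ≅ reg K G B) (x : X) :
    F.obj (reg K G A) →ₗ[B] B where
  toFun n := (toReg K G B).symm (i.hom.hom (pair K n x))
  map_add' n n' := by rw [add_pair, map_add, map_add]
  map_smul' b n := by rw [smul_pair, hom_coeff_smul, smul_reg]; rfl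

/-- The epimorphism `B ⊠ N ⟶ N` with `N = F A`, read through `F X ≅ B` and `mu`, is a morphism `F (X
⊠ N) ⟶ F A`; fullness of `F` yields `q`, and faithfulness makes it an epimorphism. -/
theorem exists_pairDual_smul [F.IsEquivalence] {X : ModuleCat.{u} (SkewMonoidAlgebra A G)}
    (i : F.obj X ≅ reg K G B) : ∃ q : obj X (res (K := K) (F.obj (reg K G A))) ⟶ reg K G A,
      Epi q ∧ ∀ (x : X) (n n' : F.obj (reg K G A)),
        pairDual K F i x n' • n = pair K n' (q.hom (mk x (toRes K n))) := by
  let p : obj (F.obj X) (res (F.obj (reg K G A))) ⟶ F.obj (reg K G A) :=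
    map i.hom (𝟙 _) ≫ regLift (K := K) (𝟙 _)
  have hp (y : F.obj X) (n : F.obj (reg K G A)) :
      p.hom (mk y (toRes K n)) = (toReg K G B).symm (i.hom.hom y) • n := by
    obtain ⟨b, hb⟩ := (toReg K G B).surjective (i.hom.hom y)
    rw [ModuleCat.comp_apply, map_mk, ← hb, AddEquiv.symm_apply_apply]
    exact regLift_id_mk b n
  have hp' : Epi p := by
    refine (ModuleCat.epi_iff_surjective _).2 fun n =>
      ⟨mk (i.inv.hom (toReg K G B 1)) (toRes K n), ?_⟩
    rw [hp, ← ModuleCat.comp_apply, i.inv_hom_id, ModuleCat.id_apply, AddEquiv.symm_apply_apply,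
      one_smul]
  refine ⟨F.preimage (inv (mu F _ _) ≫ p), ?_, fun x n n' => ?_⟩
  · refine F.epi_of_epi_map ?_
    rw [F.map_preimage]
    infer_instance
  · rw [← map_pair, ← mu_pair, F.map_preimage]
    refine (hp _ _).symm.trans ?_
    exact congrArg (fun t => t.hom (mk (pair K n' x) (toRes K n)))
      (IsIso.hom_inv_id_assoc (mu F X (res (F.obj (reg K G A)))) p).symm

/-- Everything rests on an element `z` with `q z = 1`: writing `z` as a sum of tensors `x ⊗ n` turns
`n' = n' q(z)` into a dual basis expansion of `n'`. -/
theorem exists_moritaContext [F.IsEquivalence] :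
    ∃ C : MoritaContext K A B, C.IsNondegenerate ∧ C.IsEquivariant G := by
  let N := F.obj (reg K G A)
  let _ : Module Aᵐᵒᵖ N := rightModule K F
  have op_smul_def (a : A) (n : N) : op a • n = pair K n (toReg K G A a) := rfl
  have : SMulCommClass B Aᵐᵒᵖ N := ⟨fun b a n => (smul_pair F b n _).symm⟩
  have : IsScalarTower K Aᵐᵒᵖ N := ⟨fun k a n => by
    induction a with | _ a
    rw [← op_smul, op_smul_def, op_smul_def, toReg_smul, pair_field_smul]⟩
  let X := F.objPreimage (reg K G B)
  let i : F.obj X ≅ reg K G B := F.objObjPreimageIso _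
  obtain ⟨q, hq, hqN⟩ := exists_pairDual_smul F i
  obtain ⟨z, hz⟩ := (ModuleCat.epi_iff_surjective q).1 hq (toReg K G A 1)
  have e (f : N →ₗ[B] N) : ∃! a : A, ∀ n, f n = op a • n := by
    refine existsUnique_of_exists_of_unique ?_ ?_
    -- For `z = x ⊗ n`, `f(n' q(z)) = f(x(n') n) = x(n') f(n) = n' q(x ⊗ f n)`. The claim is
    -- additive in `z`, and `q z = 1` is used only after the induction.
    · suffices ∃ a : reg K G A, ∀ n : N, f (pair K n (q.hom z)) = pair K n a by
        obtain ⟨a, ha⟩ := this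
        refine ⟨(toReg K G A).symm a, fun n => ?_⟩
        rw [op_smul_def, AddEquiv.apply_symm_apply, ← ha, hz, pair_toReg_one]
      clear hz
      induction z using obj_induction with
      | h0 => exact ⟨0, fun n => by rw [map_zero, pair_zero, map_zero]⟩
      | hmk x v =>
        obtain ⟨n, rfl⟩ := (toRes K).surjective v
        exact ⟨q.hom (mk x (toRes K (f n))), fun n' => by rw [← hqN, ← hqN, map_smul]⟩
      | hadd z z' hz hz' =>
        obtain ⟨a, ha⟩ := hz
        obtain ⟨a', ha'⟩ := hz'
        exact ⟨a + a', fun n => by rw [map_add, pair_add, map_add, ha, ha', ← pair_add]⟩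
    · intro a a' h h'
      refine sub_eq_zero.1 (pair_toReg_injective (K := K) F fun n => ?_)
      rw [← op_smul_def, MulOpposite.op_sub, sub_smul, ← h, ← h', sub_self]
  refine ⟨MoritaContext.endContext e, MoritaContext.endContext_isNondegenerate e ?_ ?_,
    ⟨MoritaContext.endContextGStructure e (resRep N) fun g b n a => ?_⟩⟩
  -- Right multiplication by `q(x ⊗ n)` is the rank-one map `n' ↦ x(n') n`; at the chosen `z` it is
  -- the identity.
  · suffices ∀ z, MoritaContext.rightMul B N ((toReg K G A).symm (q.hom z)) ∈
        AddSubmonoid.closure {f : N →ₗ[B] N |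
          ∃ (m : N →ₗ[B] B) (n : N), f = m.smulRight n} by
      convert this z
      ext n
      refine (pair_toReg_one F n).symm.trans (congrArg (pair K n) ?_)
      exact hz.symm.trans ((toReg K G A).apply_symm_apply _).symm
    have hmul (a : A) (n : N) :
        MoritaContext.rightMul B N a n = pair K n (toReg K G A a) := rfl
    intro z
    induction z using obj_induction with
    | h0 =>
      convert zero_mem (AddSubmonoid.closure _)
      ext n
      rw [hmul, map_zero, map_zero, map_zero, pair_zero]; rfl
    | hmk x v =>
      obtain ⟨n, rfl⟩ := (toRes K).surjective v
      refine AddSubmonoid.subset_closure ⟨pairDual K F i x, n, ?_⟩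
      ext n'
      rw [hmul, AddEquiv.apply_symm_apply, LinearMap.smulRight_apply, hqN]
    | hadd z z' hz hz' =>
      convert add_mem hz hz' using 1
      ext n
      rw [LinearMap.add_apply, hmul, hmul, hmul, map_add, map_add, map_add, pair_add]
  -- `F X` is generated by pairings, which `i` sends to values of functionals; take `y` to be the
  -- preimage of `1`.
  · suffices ∀ y, (toReg K G B).symm (i.hom.hom y) ∈
        AddSubmonoid.closure {b : B | ∃ (m : N →ₗ[B] B) (n : N), b = m n} by
      convert this (i.inv.hom (toReg K G B 1))
      rw [← ModuleCat.comp_apply, i.inv_hom_id, ModuleCat.id_apply, AddEquiv.symm_apply_apply]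
    intro y
    induction mem_closure_pair (K := K) F y using AddSubmonoid.closure_induction with
    | mem y hy =>
      obtain ⟨n, x, rfl⟩ := hy
      exact AddSubmonoid.subset_closure ⟨pairDual K F i x, n, rfl⟩
    | zero => rw [map_zero, map_zero]; exact zero_mem _
    | add y y' _ _ hy hy' => rw [map_add, map_add]; exact add_mem hy hy'
  · change act g (b • op a • n) = (g • b) • op (g • a) • act g n
    rw [act_smul, op_smul_def, act_pair, act_toReg]; rfl

end Functor

end SkewTensor

/-! ### From an equivariant Morita context to the functor `N ⊗_A -`. -/

namespace MoritaContext

open SkewTensor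
open scoped ModuleCat

variable {K : Type u} [Field K] {G : Type v} [Group G] {A B : Type u}
    [Ring A] [Algebra K A] [MulSemiringAction G A] [Ring B] [Algebra K B] [MulSemiringAction G B]

namespace GStructure

variable {C : MoritaContext K A B} (S : C.GStructure G)

/-- The equivariant structure on the Morita context with the bimodules exchanged. -/
def symm : C.symm.GStructure G where
  ρM := S.ρN
  ρN := S.ρM
  ρM_smul := S.ρN_smul
  ρN_smul := S.ρM_smul
  φ_equivariant := S.ψ_equivariant
  ψ_equivariant := S.φ_equivariant

theorem ρN_left (g : G) (b : B) (n : C.N) : S.ρN g (b • n) = (g • b) • S.ρN g n := by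
  simpa using S.ρN_smul g b n 1

theorem ρN_right (g : G) (a : A) (n : C.N) : S.ρN g (op a • n) = op (g • a) • S.ρN g n := by
  simpa using S.ρN_smul g 1 n a

variable [SMulCommClass G K B]

/-- The bimodule `N` as a `B ∗ G`-module. -/
def bimodule : ModuleCat.{u} (SkewMonoidAlgebra B G) :=
  ofRep C.N S.ρN S.ρN_left

/-- The identity from `N` to the `B ∗ G`-module `N`. -/
def toBimodule : C.N ≃+ S.bimodule := ofRepEquiv C.N S.ρN _

theorem smul_toBimodule (b : B) (n : C.N) : b • S.toBimodule n = S.toBimodule (b • n) :=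
  smul_ofRepEquiv C.N _ _ b n

theorem act_toBimodule (g : G) (n : C.N) : act g (S.toBimodule n) = S.toBimodule (S.ρN g n) :=
  act_ofRepEquiv C.N _ _ g n

theorem field_smul_toBimodule (k : K) (n : C.N) :
    k • S.toBimodule n = S.toBimodule (k • n) := by
  rw [field_smul (A := B), smul_toBimodule, algebraMap_smul]

variable [SMulCommClass G K A]

section Tensor

variable (X : ModuleCat.{u} (SkewMonoidAlgebra A G))

/-- The `B ∗ G`-submodule of `N ⊠ X` spanned by all `n a ⊗ x - n ⊗ a x`. -/
def relations : Submodule (SkewMonoidAlgebra B G) (obj S.bimodule (res (K := K) X)) :=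
  Submodule.span _ {z | ∃ (n : C.N) (a : A) (x : X), z =
    SkewTensor.mk (S.toBimodule (op a • n)) (toRes K x) -
      SkewTensor.mk (S.toBimodule n) (toRes K (a • x))}

/-- The `B ∗ G`-module `N ⊗_A X`. -/
def tensor : ModuleCat.{u} (SkewMonoidAlgebra B G) :=
  ModuleCat.of _ (obj S.bimodule (res (K := K) X) ⧸ S.relations X)

/-- The quotient map `N ⊠ X ⟶ N ⊗_A X`. -/
def proj : obj S.bimodule (res (K := K) X) ⟶ S.tensor X :=
  ModuleCat.ofHom (S.relations X).mkQ

variable {X}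

/-- The pure tensor `n ⊗ x` in `N ⊗_A X`. -/
def tmk (n : C.N) (x : X) : S.tensor X :=
  (S.proj X).hom (SkewTensor.mk (S.toBimodule n) (toRes K x))

theorem tmk_add (n : C.N) (x y : X) : S.tmk n (x + y) = S.tmk n x + S.tmk n y := by
  rw [tmk, tmk, tmk, map_add, mk_add, map_add]

theorem add_tmk (n n' : C.N) (x : X) : S.tmk (n + n') x = S.tmk n x + S.tmk n' x := by
  rw [tmk, tmk, tmk, map_add, add_mk, map_add]

theorem tmk_zero (n : C.N) : S.tmk n (0 : X) = 0 := by
  rw [tmk, map_zero, mk_zero, map_zero]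

theorem smul_tmk (b : B) (n : C.N) (x : X) : b • S.tmk n x = S.tmk (b • n) x := by
  rw [tmk, ← hom_coeff_smul, coeff_smul_mk, smul_toBimodule, tmk]

theorem act_tmk (g : G) (n : C.N) (x : X) : act g (S.tmk n x) = S.tmk (S.ρN g n) (act g x) := by
  rw [tmk, ← hom_act, act_mk, act_toBimodule, res_ρ, tmk]

theorem tmk_smul (n : C.N) (a : A) (x : X) : S.tmk n (a • x) = S.tmk (op a • n) x :=
  ((Submodule.Quotient.eq (S.relations X)).2 (Submodule.subset_span ⟨n, a, x, rfl⟩)).symm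

@[elab_as_elim]
theorem tensor_induction {p : S.tensor X → Prop} (z : S.tensor X) (h0 : p 0)
    (ht : ∀ n x, p (S.tmk n x)) (hadd : ∀ y z, p y → p z → p (y + z)) : p z := by
  obtain ⟨w, rfl⟩ := (S.relations X).mkQ_surjective z
  change p ((S.proj X).hom w)
  induction w using obj_induction with
  | h0 => rwa [map_zero]
  | hmk n x =>
    obtain ⟨n, rfl⟩ := S.toBimodule.surjective n
    obtain ⟨x, rfl⟩ := (toRes K).surjective x
    exact ht n x
  | hadd y z hy hz => rw [map_add]; exact hadd _ _ hy hz

/-- The map `f` is only additive, but `b g` carries the relation of `(n, a, x)` to that of `(b (g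
n), g a, g x)`, so the generators span the submodule additively. -/
theorem map_eq_zero_of_mem_relations {Y : Type*} [AddCommGroup Y]
    (f : obj S.bimodule (res (K := K) X) →+ Y)
    (hf : ∀ (n : C.N) (a : A) (x : X), f (SkewTensor.mk (S.toBimodule (op a • n)) (toRes K x)) =
      f (SkewTensor.mk (S.toBimodule n) (toRes K (a • x))))
    (z : obj S.bimodule (res (K := K) X)) (hz : z ∈ S.relations X) : f z = 0 := by
  induction hz using Submodule.closure_induction with
  | zero => exact map_zero f
  | add y z _ _ hy hz => rw [map_add, hy, hz, add_zero]
  | smul_mem r z hz =>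
    obtain ⟨n, a, x, rfl⟩ := hz
    induction r using SkewMonoidAlgebra.induction with
    | h0 => rw [zero_smul, map_zero]
    | ha g b r _ _ ih =>
      rw [add_smul, map_add, ih, add_zero, smul_sub, SkewTensor.single_smul,
        SkewTensor.single_smul, act_mk, act_mk, coeff_smul_mk, coeff_smul_mk, act_toBimodule,
        act_toBimodule, smul_toBimodule, smul_toBimodule, ρN_right, res_ρ, res_ρ, act_smul,
        smul_comm, map_sub, hf, sub_self]

/-- The additive map on `N ⊗_A X` given by a balanced biadditive map. -/
def descend {Y : Type u} [AddCommGroup Y] (f : C.N → X → Y)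
    (add_left : ∀ n n' x, f (n + n') x = f n x + f n' x)
    (add_right : ∀ n x y, f n (x + y) = f n x + f n y)
    (balanced : ∀ n (a : A) x, f (op a • n) x = f n (a • x)) : S.tensor X →+ Y :=
  let f' : S.bimodule →+ res (K := K) X →+ Y :=
    AddMonoidHom.mk' (fun n => AddMonoidHom.mk'
      (fun x => f (S.toBimodule.symm n) ((toRes K).symm x))
      (fun x y => by rw [map_add, add_right]))
      (fun n n' => by ext x; simp [add_left])
  -- `K`-balancedness is a case of `A`-balancedness, since the right `A`-action on `N` extends its
  -- `K`-action.
  have hf' (k : K) (n : S.bimodule) (x : res (K := K) X) : f' (k • n) x = f' n (k • x) := by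
    change f _ _ = f _ _
    obtain ⟨n, rfl⟩ := S.toBimodule.surjective n
    rw [field_smul_toBimodule, AddEquiv.symm_apply_apply, AddEquiv.symm_apply_apply, map_smul,
      field_smul (A := A), ← balanced, ← algebraMap_smul Aᵐᵒᵖ k n]
    rfl
  QuotientAddGroup.lift (S.relations X).toAddSubgroup
    ((TensorProduct.liftAddHom f' hf').comp
      ((objEquiv S.bimodule (res (K := K) X)).symm.toLinearMap.toAddMonoidHom))
    (S.map_eq_zero_of_mem_relations _ fun n a x => balanced n a x)

@[simp]
theorem descend_tmk {Y : Type u} [AddCommGroup Y] (f : C.N → X → Y) (h₁ h₂ h₃)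
    (n : C.N) (x : X) : S.descend f h₁ h₂ h₃ (S.tmk n x) = f n x := rfl

/-- The morphism on `N ⊗_A X` given by a balanced biadditive equivariant map. -/
def tensorLift {Y : ModuleCat.{u} (SkewMonoidAlgebra B G)} (f : C.N → X → Y)
    (add_left : ∀ n n' x, f (n + n') x = f n x + f n' x)
    (add_right : ∀ n x y, f n (x + y) = f n x + f n y)
    (balanced : ∀ n (a : A) x, f (op a • n) x = f n (a • x))
    (hB : ∀ (b : B) n x, f (b • n) x = b • f n x)
    (hG : ∀ g n x, f (S.ρN g n) (act g x) = act g (f n x)) : S.tensor X ⟶ Y :=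
  homMk (S.descend f add_left add_right balanced)
    (fun b z => by
      induction z using tensor_induction with
      | h0 => rw [smul_zero, map_zero, smul_zero]
      | ht n x => rw [smul_tmk, descend_tmk, descend_tmk, hB]
      | hadd y z hy hz => rw [smul_add, map_add, hy, hz, map_add, smul_add])
    (fun g z => by
      induction z using tensor_induction with
      | h0 => rw [act, smul_zero, map_zero, act, smul_zero]
      | ht n x => rw [act_tmk, descend_tmk, descend_tmk, hG]
      | hadd y z hy hz => rw [act_add, map_add, hy, hz, map_add, act_add])

theorem tensor_hom_ext {Y : ModuleCat.{u} (SkewMonoidAlgebra B G)} {f f' : S.tensor X ⟶ Y}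
    (h : ∀ n x, f.hom (S.tmk n x) = f'.hom (S.tmk n x)) : f = f' := by
  ext z
  induction z using tensor_induction with
  | h0 => rw [map_zero, map_zero]
  | ht n x => exact h n x
  | hadd y z hy hz => rw [map_add, map_add, hy, hz]

end Tensor

/-- The morphism `N ⊗_A f`. -/
def tensorMap {X Y : ModuleCat.{u} (SkewMonoidAlgebra A G)} (f : X ⟶ Y) :
    S.tensor X ⟶ S.tensor Y :=
  S.tensorLift (fun n x => S.tmk n (f.hom x))
    (fun n n' x => S.add_tmk n n' _)
    (fun n x y => by rw [map_add, tmk_add])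
    (fun n a x => by rw [hom_coeff_smul, tmk_smul])
    (fun b n x => (S.smul_tmk b n _).symm)
    (fun g n x => by rw [hom_act, act_tmk])

@[simp]
theorem tensorMap_tmk {X Y : ModuleCat.{u} (SkewMonoidAlgebra A G)} (f : X ⟶ Y) (n : C.N)
    (x : X) : (S.tensorMap f).hom (S.tmk n x) = S.tmk n (f.hom x) := rfl

/-- The functor `N ⊗_A -`. -/
def tensorFunctor :
    ModuleCat.{u} (SkewMonoidAlgebra A G) ⥤ ModuleCat.{u} (SkewMonoidAlgebra B G) where
  obj X := S.tensor X
  map f := S.tensorMap f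
  map_id _ := S.tensor_hom_ext fun _ _ => rfl
  map_comp _ _ := S.tensor_hom_ext fun _ _ => rfl

/-! ### The evaluation `M ⊗_B (N ⊗_A X) ⟶ X` and the equivalence of categories. -/

section Counit

variable {X : ModuleCat.{u} (SkewMonoidAlgebra A G)}

/-- The map `N ⊗_A X → X`, `n ⊗ x ↦ φ (m ⊗ n) x`. -/
def contract (m : C.M) : S.tensor X →+ X :=
  S.descend (fun n x => C.φ (.tmul K B m n) • x)
    (fun n n' x => by
      rw [← BalancedTensor.mk_apply, map_add, map_add, add_smul]; rfl)
    (fun n x y => smul_add _ _ _)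
    (fun n a x => by rw [C.φ_right, mul_smul])

theorem contract_tmk (m : C.M) (n : C.N) (x : X) :
    S.contract m (S.tmk n x) = C.φ (.tmul K B m n) • x := rfl

/-- The evaluation `M ⊗_B (N ⊗_A X) ⟶ X`, `m ⊗ (n ⊗ x) ↦ φ (m ⊗ n) x`. -/
def counit (X : ModuleCat.{u} (SkewMonoidAlgebra A G)) : S.symm.tensor (S.tensor X) ⟶ X :=
  S.symm.tensorLift (fun m z => S.contract m z)
    (fun m m' z => by
      induction z using tensor_induction with
      | h0 => simp
      | ht n x =>
        rw [contract_tmk, contract_tmk, contract_tmk, ← add_smul, ← map_add]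
        exact congrArg (fun t => C.φ t • x)
          (LinearMap.map_add₂ (BalancedTensor.mk K B C.M C.N) _ _ _)
      | hadd y z hy hz => rw [map_add, map_add, map_add, hy, hz]; abel)
    (fun m y z => map_add _ _ _)
    (fun m b z => by
      induction z using tensor_induction with
      | h0 => simp
      | ht n x =>
        rw [smul_tmk, contract_tmk, contract_tmk, BalancedTensor.smul_tmul]
      | hadd y z hy hz => rw [map_add, smul_add, map_add, hy, hz])
    (fun a m z => by
      induction z using tensor_induction with
      | h0 => simp
      | ht n x => rw [contract_tmk, contract_tmk, C.φ_left, mul_smul]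
      | hadd y z hy hz => rw [map_add, map_add, hy, hz, smul_add])
    (fun g m z => by
      induction z using tensor_induction with
      | h0 => simp [act]
      | ht n x =>
        rw [act_tmk, contract_tmk, contract_tmk, act_smul, ← S.φ_equivariant]; rfl
      | hadd y z hy hz => rw [act_add, map_add, map_add, hy, hz, act_add])

theorem counit_tmk (m : C.M) (n : C.N) (x : X) :
    (S.counit X).hom (S.symm.tmk m (S.tmk n x)) = C.φ (.tmul K B m n) • x := rfl

/-- For `w = m ⊗ n` take `l x = m ⊗ (n ⊗ x)`. The second identity is `m ⊗ n φ(m' ⊗ n') ⊗ x = m ⊗ ψ(n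
⊗ m') n' ⊗ x = m ψ(n ⊗ m') ⊗ n' ⊗ x = φ(m ⊗ n) m' ⊗ n' ⊗ x`. -/
theorem exists_counit_smul (w : BalancedTensor K B C.M C.N) :
    ∃ l : X →+ S.symm.tensor (S.tensor X),
      (∀ x, (S.counit X).hom (l x) = C.φ w • x) ∧
      ∀ z, l ((S.counit X).hom z) = C.φ w • z := by
  induction w using BalancedTensor.induction with
  | h0 => exact ⟨0, fun x => by simp, fun z => by simp⟩
  | ht m n =>
    refine ⟨AddMonoidHom.mk' (fun x => S.symm.tmk m (S.tmk n x))
      (fun x y => by rw [tmk_add, tmk_add]), fun x => S.counit_tmk m n x, fun z => ?_⟩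
    rw [AddMonoidHom.mk'_apply]
    induction z using tensor_induction with
    | h0 =>
      rw [map_zero, smul_zero, tmk_zero, tmk_zero]
    | ht m' z =>
      induction z using tensor_induction with
      | h0 => rw [tmk_zero, map_zero, smul_zero, tmk_zero, tmk_zero]
      | ht n' x =>
        rw [counit_tmk, tmk_smul, ← C.ψ_smul, ← smul_tmk, tmk_smul, smul_tmk, C.φ_smul]
      | hadd y z hy hz => rw [tmk_add, map_add, tmk_add, tmk_add, hy, hz, smul_add]
    | hadd y z hy hz => rw [map_add, tmk_add, tmk_add, hy, hz, smul_add]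
  | hadd v w hv hw =>
    obtain ⟨l, hl, hl'⟩ := hv
    obtain ⟨l', h₁, h₂⟩ := hw
    exact ⟨l + l', fun x => by rw [AddMonoidHom.add_apply, map_add, hl, h₁, map_add, add_smul],
      fun x => by rw [AddMonoidHom.add_apply, hl', h₂, map_add, add_smul]⟩

/-- When `φ w = 1`, the map `l` is a two-sided inverse; it need only be a function, because a
bijective morphism of modules is an isomorphism. -/
theorem counit_isIso (hφ : Function.Surjective C.φ) (X : ModuleCat.{u} (SkewMonoidAlgebra A G)) :
    IsIso (S.counit X) := by
  obtain ⟨w, hw⟩ := hφ 1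
  obtain ⟨l, hl, hl'⟩ := S.exists_counit_smul (X := X) w
  refine (ConcreteCategory.isIso_iff_bijective _).2 ⟨fun z z' h => ?_, fun x => ⟨l x, ?_⟩⟩
  · rw [← one_smul A z, ← hw, ← hl', ← one_smul A z', ← hw, ← hl']
    exact congrArg l h
  · exact (hl x).trans (by rw [hw, one_smul])

theorem counit_naturality {X Y : ModuleCat.{u} (SkewMonoidAlgebra A G)} (f : X ⟶ Y) :
    S.symm.tensorMap (S.tensorMap f) ≫ S.counit Y = S.counit X ≫ f :=
  S.symm.tensor_hom_ext fun m z => by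
    induction z using tensor_induction with
    | h0 => rw [tmk_zero, map_zero, map_zero]
    | ht n x => exact (hom_coeff_smul f _ x).symm
    | hadd y z hy hz => rw [tmk_add, map_add, map_add, hy, hz]

/-- The natural isomorphism `M ⊗_B (N ⊗_A X) ≅ X`. -/
def counitIso (hφ : Function.Surjective C.φ) :
    S.tensorFunctor ⋙ S.symm.tensorFunctor ≅ 𝟭 _ :=
  NatIso.ofComponents (fun X => @asIso _ _ _ _ (S.counit X) (S.counit_isIso hφ X))
    fun f => S.counit_naturality f

/-- The equivalence of categories given by a nondegenerate equivariant Morita context. -/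
def equivalence (hC : C.IsNondegenerate) :
    ModuleCat.{u} (SkewMonoidAlgebra A G) ≌ ModuleCat.{u} (SkewMonoidAlgebra B G) :=
  CategoryTheory.Equivalence.mk S.tensorFunctor S.symm.tensorFunctor (S.counitIso hC.1.2).symm
    (S.symm.counitIso hC.2.2)

end Counit

/-! ### The isomorphism `(N ⊗_A X) ⊠ V ≅ N ⊗_A (X ⊠ V)` and its coherence. -/

section RightLinear

variable {X : ModuleCat.{u} (SkewMonoidAlgebra A G)} {V : Rep.{u} K G}

/-- The scalar travels from `X` through `A` to the right of `N`, and from there to the left through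
`B`; this uses that `K` acts equally on both sides of `N`. -/
theorem tmk_field_smul (n : C.N) (k : K) (x : X) : S.tmk n (k • x) = k • S.tmk n x := by
  rw [field_smul (A := A), tmk_smul, ← algebraMap_smul B k (S.tmk n x), smul_tmk, algebraMap_smul,
    ← algebraMap_smul Aᵐᵒᵖ k n]
  rfl

theorem hom_ext_obj_tensor {Y : ModuleCat.{u} (SkewMonoidAlgebra B G)}
    {f f' : obj (S.tensor X) V ⟶ Y}
    (h : ∀ n x v, f.hom (SkewTensor.mk (S.tmk n x) v) = f'.hom (SkewTensor.mk (S.tmk n x) v)) :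
    f = f' := by
  refine hom_ext fun z v => ?_
  induction z using tensor_induction with
  | h0 => rw [zero_mk, map_zero, map_zero]
  | ht n x => exact h n x v
  | hadd y z hy hz => rw [add_mk, map_add, map_add, hy, hz]

theorem hom_ext_tensor_obj {Y : ModuleCat.{u} (SkewMonoidAlgebra B G)}
    {f f' : S.tensor (obj X V) ⟶ Y}
    (h : ∀ n x v, f.hom (S.tmk n (SkewTensor.mk x v)) = f'.hom (S.tmk n (SkewTensor.mk x v))) :
    f = f' := by
  refine S.tensor_hom_ext fun n y => ?_
  induction y using obj_induction with
  | h0 => rw [tmk_zero, map_zero, map_zero]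
  | hmk x v => exact h n x v
  | hadd y z hy hz => rw [tmk_add, map_add, map_add, hy, hz]

/-- The map `N ⊗_A X → N ⊗_A (X ⊠ V)`, `n ⊗ x ↦ n ⊗ (x ⊗ v)`. -/
def tensorRight (v : V) : S.tensor X →+ S.tensor (obj X V) :=
  S.descend (fun n x => S.tmk n (SkewTensor.mk x v))
    (fun n n' x => S.add_tmk n n' _)
    (fun n x y => by rw [add_mk, tmk_add])
    (fun n a x => by rw [← coeff_smul_mk, tmk_smul])

theorem tensorRight_tmk (v : V) (n : C.N) (x : X) :
    S.tensorRight v (S.tmk n x) = S.tmk n (SkewTensor.mk x v) := rfl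

variable (X V) in
/-- The morphism `(N ⊗_A X) ⊠ V ⟶ N ⊗_A (X ⊠ V)`. -/
def tensorMu : obj (S.tensor X) V ⟶ S.tensor (obj X V) :=
  lift (fun z v => S.tensorRight v z)
    (fun y z v => map_add _ _ _)
    (fun z v w => by
      induction z using tensor_induction with
      | h0 => simp
      | ht n x => rw [tensorRight_tmk, mk_add, tmk_add]; rfl
      | hadd y z hy hz => rw [map_add, map_add, map_add, hy, hz]; abel)
    (fun k z v => by
      induction z using tensor_induction with
      | h0 => simp
      | ht n x => rw [tensorRight_tmk, mk_smul, tmk_field_smul]; rfl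
      | hadd y z hy hz => rw [map_add, map_add, hy, hz, smul_add])
    (fun b z v => by
      induction z using tensor_induction with
      | h0 => simp
      | ht n x => rw [smul_tmk, tensorRight_tmk, tensorRight_tmk, smul_tmk]
      | hadd y z hy hz => rw [smul_add, map_add, map_add, hy, hz, smul_add])
    (fun g z v => by
      induction z using tensor_induction with
      | h0 => simp [act]
      | ht n x => rw [act_tmk, tensorRight_tmk, tensorRight_tmk, act_tmk, act_mk]
      | hadd y z hy hz => rw [act_add, map_add, map_add, hy, hz, act_add])

theorem tensorMu_mk (n : C.N) (x : X) (v : V) :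
    (S.tensorMu X V).hom (SkewTensor.mk (S.tmk n x) v) = S.tmk n (SkewTensor.mk x v) := rfl

/-- The map `X ⊠ V → (N ⊗_A X) ⊠ V`, `x ⊗ v ↦ (n ⊗ x) ⊗ v`. -/
def tensorLeft (n : C.N) : obj X V →+ obj (S.tensor X) V :=
  let l : X →ₗ[K] S.tensor X :=
    { toFun := S.tmk n
      map_add' := S.tmk_add n
      map_smul' := S.tmk_field_smul n }
  ((objEquiv (S.tensor X) V).toLinearMap ∘ₗ l.rTensor V ∘ₗ
    (objEquiv X V).symm.toLinearMap).toAddMonoidHom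

theorem tensorLeft_mk (n : C.N) (x : X) (v : V) :
    S.tensorLeft n (SkewTensor.mk x v) = SkewTensor.mk (S.tmk n x) v := rfl

variable (X V) in
/-- The morphism `N ⊗_A (X ⊠ V) ⟶ (N ⊗_A X) ⊠ V`. -/
def tensorDelta : S.tensor (obj X V) ⟶ obj (S.tensor X) V :=
  S.tensorLift (fun n y => S.tensorLeft n y)
    (fun n n' y => by
      induction y using obj_induction with
      | h0 => simp
      | hmk x v => rw [tensorLeft_mk, add_tmk, add_mk]; rfl
      | hadd y z hy hz => rw [map_add, map_add, map_add, hy, hz]; abel)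
    (fun n y z => map_add _ _ _)
    (fun n a y => by
      induction y using obj_induction with
      | h0 => simp
      | hmk x v => rw [coeff_smul_mk, tensorLeft_mk, tensorLeft_mk, tmk_smul]
      | hadd y z hy hz => rw [map_add, smul_add, map_add, hy, hz])
    (fun b n y => by
      induction y using obj_induction with
      | h0 => simp
      | hmk x v => rw [tensorLeft_mk, tensorLeft_mk, ← smul_tmk, coeff_smul_mk]
      | hadd y z hy hz => rw [map_add, map_add, hy, hz, smul_add])
    (fun g n y => by
      induction y using obj_induction with
      | h0 => simp [act]
      | hmk x v => rw [act_mk, tensorLeft_mk, tensorLeft_mk, ← act_tmk, act_mk]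
      | hadd y z hy hz => rw [act_add, map_add, map_add, hy, hz, act_add])

variable (X) in
theorem tensorMu_assoc (V W : Rep.{u} K G) :
    S.tensorMu X (V ⊗ W) ≫ S.tensorMap (assocIso X V W).hom =
      (assocIso (S.tensor X) V W).hom ≫ SkewTensor.map (S.tensorMu X V) (𝟙 W) ≫
        S.tensorMu (obj X V) W := by
  refine hom_ext₂ fun z v w => ?_
  induction z using tensor_induction with
  | h0 => rw [zero_mk, map_zero, map_zero]
  | ht n x => rfl
  | hadd y z hy hz => rw [add_mk, map_add, map_add, hy, hz]

variable (X V) in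
theorem tensorMu_tensorDelta : S.tensorMu X V ≫ S.tensorDelta X V = 𝟙 _ :=
  S.hom_ext_obj_tensor fun _ _ _ => rfl

variable (X V) in
theorem tensorDelta_tensorMu : S.tensorDelta X V ≫ S.tensorMu X V = 𝟙 _ :=
  S.hom_ext_tensor_obj fun _ _ _ => rfl

variable (X) in
theorem tensorMu_unit :
    (unitIso (K := K) (S.tensor X)).hom =
      S.tensorMu X (𝟙_ (Rep.{u} K G)) ≫ S.tensorMap (unitIso X).hom :=
  S.hom_ext_obj_tensor fun n x (k : K) => by
    rw [unitIso_hom_mk, ModuleCat.comp_apply, tensorMu_mk, tensorMap_tmk, unitIso_hom_mk,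
      tmk_field_smul]

variable (X) in
theorem tensorDelta_assoc (V W : Rep.{u} K G) :
    S.tensorDelta X (V ⊗ W) ≫ (assocIso (S.tensor X) V W).hom =
      S.tensorMap (assocIso X V W).hom ≫ S.tensorDelta (obj X V) W ≫
        SkewTensor.map (S.tensorDelta X V) (𝟙 W) := by
  refine S.tensor_hom_ext fun n y => ?_
  induction y using obj_induction with
  | h0 => rw [tmk_zero, map_zero, map_zero]
  | hmk x t =>
    induction t using TensorProduct.induction_on with
    | zero => rw [mk_zero, tmk_zero, map_zero, map_zero]
    | tmul v w => rfl
    | add t t' ht ht' => rw [mk_add, tmk_add, map_add, map_add, ht, ht']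
  | hadd y z hy hz => rw [tmk_add, map_add, map_add, hy, hz]

/-- Both structure maps merely rebracket pure tensors, so the axioms hold there by definition; only
`μᵣ_unitality` has to move a scalar across `⊗_A`. -/
instance rightLinear : S.tensorFunctor.RightLinear (Rep.{u} K G) where
  μᵣ X V := S.tensorMu X V
  δᵣ X V := S.tensorDelta X V
  μᵣ_naturality_right _ _ _ _ := S.hom_ext_obj_tensor fun _ _ _ => rfl
  μᵣ_naturality_left _ _ := S.hom_ext_obj_tensor fun _ _ _ => rfl
  μᵣ_associativity X V W := S.tensorMu_assoc X V W
  μᵣ_unitality X := S.tensorMu_unit X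
  δᵣ_naturality_right _ _ _ _ := S.hom_ext_tensor_obj fun _ _ _ => rfl
  δᵣ_naturality_left _ _ := S.hom_ext_tensor_obj fun _ _ _ => rfl
  δᵣ_associativity X V W := S.tensorDelta_assoc X V W
  δᵣ_unitality_inv _ := S.tensor_hom_ext fun _ _ => rfl
  μᵣ_comp_δᵣ X V := S.tensorMu_tensorDelta X V
  δᵣ_comp_μᵣ X V := S.tensorDelta_tensorMu X V

end RightLinear

end GStructure

end MoritaContext

end

theorem mainTheorem8 {K : Type u} [Field K] {G : Type v} [Group G] {A B : Type u}
    [Ring A] [Algebra K A] [MulSemiringAction G A] [SMulCommClass G K A]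
    [Ring B] [Algebra K B] [MulSemiringAction G B] [SMulCommClass G K B] :
    ModuleCategoryEquivalent (Rep.{u} K G)
        (ModuleCat.{u} (SkewMonoidAlgebra A G)) (ModuleCat.{u} (SkewMonoidAlgebra B G)) ↔
      ∃ C : MoritaContext K A B, C.IsNondegenerate ∧ C.IsEquivariant G := by
  constructor
  · rintro ⟨e, ⟨h⟩⟩
    exact SkewTensor.exists_moritaContext e.functor
  · rintro ⟨C, hC, ⟨S⟩⟩
    exact ⟨S.equivalence hC, ⟨S.rightLinear⟩⟩
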